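/- Let $f(z)=\lambda e^z$, $\lambda\in\mathbb C\setminus\{0\}$, have an attracting periodic cycle $z_0,z_1,\dots,z_{p-1},z_p=z_0$, $z_j=f^j(z_0)$, of minimal period $p\ge 2$, so that $|(f^p)'(z_0)|<1$. Let $J(f)$ be the Julia set of $f$ and, for $0\le j<p$, let $U_j$ be the component containing $z_j$ of the basin of attraction of the cycle, with the cycle numbered so that $0\in U_1$. Let $B_{p+1}\subset U_1$ be any bounded simply connected domain with $0,z_1\in B_{p+1}$, whose boundary is a Jordan curve in $U_1$, and with $\overline{f^p(B_{p+1})}\subset B_{p+1}$, and put $B_p=f^{-1}(B_{p+1})$. Let $C_p\subset B_p$ be any domain that contains $z_0$ and some left half-plane, whose boundary is a curve homeomorphic to $\mathbb R$ with imaginary part tending to $+\infty$ at one end and to $-\infty$ at the other, and such that for some $L_1,L_2>0$ one has $\partial C_p=\partial B_p$ in $\{|\mathrm{Im}\, z|<L_1\}$ while each of the sets $\partial C_p\cap\{\mathrm{Im}\, z>L_2\}$ and $\partial C_p\cap\{\mathrm{Im}\, z<-L_2\}$ is a vertical half-line. For $j=p-1,\dots,0$ let $C_j$ be the component of $f^{-1}(C_{j+1})$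 containing $z_j$, and suppose that $\overline{B_{p+1}}\subset C_1$ (which holds when $L_1$ is large enough). Let $\mathcal H_0$ be any component of $\mathbb C\setminus C_0$ and put $\mathcal H_s=\mathcal H_0+2\pi i s$ for $s\in\mathbb Z$; these are the components of $\mathbb C\setminus C_0$. Let $k_1,\dots,k_{p-1}$ be the integers with $U_j\subset\mathcal H_{k_j}$ for $1\le j\le p-1$, and write $\underline k=(k_1,\dots,k_{p-1})$. A point $z$ has itinerary $(t_0,t_1,\dots)\in\mathbb Z^{\mathbb N}$ if $f^n(z)\in\mathcal H_{t_n}$ for all $n\ge 0$. Let $$\Sigma'_{\underline k}=\{(s_0,\underline k,s_1,\underline k,s_2,\dots): s_n\in\mathbb Z \text{ for all } n,\ s_n\notin\{k_1,\dots,k_{p-1}\}\text{ for infinitely many } n\}.$$ Then the Hausdorff dimension of the set $$\{z\in J(f): z\text{ has itinerary in }\Sigma'_{\underline k}\text{ and the forward orbit of } z \text{ under } f \text{ is bounded}\}$$ is greater than $1$. -/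

import Mathlib

open Set Filter Topology

noncomputable section

namespace ExpBasin

/-- The exponential map `f(z) = lam * exp z`. -/
def expMap (lam : ℂ) (z : ℂ) : ℂ := lam * Complex.exp z

/-- The iterates `g^n` form a normal family on the (connected) open set `V`: every subsequence has
a further subsequence that converges locally uniformly on `V`, either to a finite function or to
infinity. -/
def NormalIterates (g : ℂ → ℂ) (V : Set ℂ) : Prop :=
  ∀ φ : ℕ → ℕ, StrictMono φ → ∃ ψ : ℕ → ℕ, StrictMono ψ ∧
    ((∃ h : ℂ → ℂ, TendstoLocallyUniformlyOn (fun n => g^[φ (ψ n)]) h atTop V) ∨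
      ∀ K : Set ℂ, K ⊆ V → IsCompact K → ∀ M : ℝ, ∀ᶠ n in atTop, ∀ z ∈ K, M ≤ ‖g^[φ (ψ n)] z‖)

/-- The Julia set of an entire function: the points no disc around which is a domain of normality
of the iterates. -/
def juliaSet (g : ℂ → ℂ) : Set ℂ :=
  {z | ¬ ∃ r : ℝ, 0 < r ∧ NormalIterates g (Metric.ball z r)}

/-- `z₀` generates an attracting periodic cycle of (minimal) period `p`. -/
structure IsAttractingCycle (lam : ℂ) (p : ℕ) (z₀ : ℂ) : Prop where
  minimalPeriod_eq : Function.minimalPeriod (expMap lam) z₀ = p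
  attracting : ‖deriv ((expMap lam)^[p]) z₀‖ < 1

/-- The point `z_j = f^j(z₀)` of the cycle. -/
def cyclePt (lam z₀ : ℂ) (j : ℕ) : ℂ := (expMap lam)^[j] z₀

/-- The entire basin of attraction of the cycle `z₀, …, z_{p-1}`. -/
def basin (lam : ℂ) (p : ℕ) (z₀ : ℂ) : Set ℂ :=
  {z | ∃ j < p, Tendsto (fun n : ℕ => (expMap lam)^[n * p] z) atTop (𝓝 (cyclePt lam z₀ j))}

/-- `U_j`, the component of the basin that contains `z_j`. -/
def basinComp (lam : ℂ) (p : ℕ) (z₀ : ℂ) (j : ℕ) : Set ℂ :=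
  connectedComponentIn (basin lam p z₀) (cyclePt lam z₀ j)

/-- `D` is an admissible choice of the domain `B_{p+1}`: a simply connected domain in `U_1`, bounded
by a Jordan curve in `U_1`, containing `0` and `z_1`, with `closure (f^p(D)) ⊆ D`. -/
structure IsInitialDomain (lam : ℂ) (p : ℕ) (z₀ : ℂ) (D : Set ℂ) : Prop where
  isOpen : IsOpen D
  simplyConnected : IsSimplyConnected D
  bounded : Bornology.IsBounded D
  subset_basinComp : D ⊆ basinComp lam p z₀ 1
  zero_mem : (0 : ℂ) ∈ D
  cyclePt_mem : cyclePt lam z₀ 1 ∈ D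
  jordan : ∃ γ : Circle → ℂ, Continuous γ ∧ Function.Injective γ ∧ range γ = frontier D
  frontier_subset : frontier D ⊆ basinComp lam p z₀ 1
  closure_image_subset : closure ((expMap lam)^[p] '' D) ⊆ D

/-- Successive pull-backs of a set `C = C_p` along the cycle: `pullback lam p z₀ C i` is `C_{p-i}`,
where `C_j` is the component of `f⁻¹(C_{j+1})` that contains `z_j`. -/
def pullback (lam : ℂ) (p : ℕ) (z₀ : ℂ) (C : Set ℂ) : ℕ → Set ℂ
  | 0 => C
  | i + 1 => connectedComponentIn (expMap lam ⁻¹' pullback lam p z₀ C i)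
      (cyclePt lam z₀ (p - (i + 1)))

/-- The set `C_j`, `0 ≤ j ≤ p`, where `C = C_p`. -/
def cSet (lam : ℂ) (p : ℕ) (z₀ : ℂ) (C : Set ℂ) (j : ℕ) : Set ℂ :=
  pullback lam p z₀ C (p - j)

/-- `C` is an admissible choice of the domain `C_p ⊆ B_p = f⁻¹(D)`, where `D = B_{p+1}`. -/
structure IsTruncatedDomain (lam : ℂ) (p : ℕ) (z₀ : ℂ) (D C : Set ℂ) : Prop where
  isOpen : IsOpen C
  isConnected : IsConnected C
  subset : C ⊆ expMap lam ⁻¹' D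
  cyclePt_mem : z₀ ∈ C
  halfPlane : ∃ c : ℝ, {z : ℂ | z.re < c} ⊆ C
  /-- The boundary is an embedded line with ends going to infinity upwards and downwards. -/
  curve : ∃ γ : ℝ → ℂ, Continuous γ ∧ Function.Injective γ ∧ range γ = frontier C ∧
    Tendsto (fun t => (γ t).im) atTop atTop ∧ Tendsto (fun t => (γ t).im) atBot atBot
  /-- Near the real axis the boundary is that of `B_p`. -/
  coincide : ∃ L₁ : ℝ, 0 < L₁ ∧
    frontier C ∩ {z | |z.im| < L₁} = frontier (expMap lam ⁻¹' D) ∩ {z | |z.im| < L₁}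
  /-- Far from the real axis the boundary is vertical. -/
  vertical : ∃ L₂ x₁ x₂ : ℝ, 0 < L₂ ∧
    frontier C ∩ {z | L₂ < z.im} = {z | z.re = x₁ ∧ L₂ < z.im} ∧
    frontier C ∩ {z | z.im < -L₂} = {z | z.re = x₂ ∧ z.im < -L₂}
  /-- `L₁` is so large that `C_1` contains the closure of `B_{p+1}`. -/
  closure_subset : closure D ⊆ cSet lam p z₀ C 1

/-- The set `H_s = H_0 + 2 π i s`, where `H_0` is the component of the complement of `C_0` that
contains the base point `w`. -/
def hSet (lam : ℂ) (p : ℕ) (z₀ : ℂ) (C : Set ℂ) (w : ℂ) (s : ℤ) : Set ℂ :=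
  (fun z : ℂ => z + 2 * (Real.pi : ℂ) * Complex.I * (s : ℂ)) ''
    connectedComponentIn (cSet lam p z₀ C 0)ᶜ w

/-- `s` is an itinerary of `z` with respect to the sets `H_s`: `f^n(z) ∈ H_{s_n}` for all `n`. -/
def IsItinerary (lam : ℂ) (H : ℤ → Set ℂ) (z : ℂ) (s : ℕ → ℤ) : Prop :=
  ∀ n : ℕ, (expMap lam)^[n] z ∈ H (s n)

/-- The sequences `(s_0, k_1, …, k_{p-1}, s_1, k_1, …, k_{p-1}, …)` such that `s_n` is not one of
`k_1, …, k_{p-1}` for infinitely many `n`. Only the values `k 1, …, k (p - 1)` matter. -/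
def sigmaPrime (p : ℕ) (k : ℕ → ℤ) : Set (ℕ → ℤ) :=
  {s | (∀ n j : ℕ, 1 ≤ j → j < p → s (n * p + j) = k j) ∧
    ∃ᶠ n : ℕ in atTop, ∀ j : ℕ, 1 ≤ j → j < p → s (n * p) ≠ k j}

end ExpBasin

end

noncomputable section

namespace ExpBasin

/-! ### Lifting through the exponential map -/

/-! The sets `H_s` are the images of the complement of `C_1` under the inverse branches of `f`, and
each lies in a horizontal strip of uniformly bounded height. This rests on a logarithm with bounded
imaginary part off `C_1`, which exists because `C_1` contains `0` and a curve running to infinity in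
the direction of the positive real axis (`IsAttractingCycle.exists_branch`). A point of `H_t` with
`t` large avoids `C_1, …, C_p`, so it can be pulled back through `H_{k_{p-1}}, …, H_{k_1}` and
finally into any `H_s` (`IsAttractingCycle.isTractFamily`).

Since `|f'| = |f|`, and since in a fixed strip `|y|` equals `log |f(y)|` up to a bounded error, the
derivative of `f^p` along such a pull-back of `x` is at most about `|x| · log |x| ⋯ log^{p-1} |x|`,
with iterated logarithms. For `x` in `H_{qτ}` of size comparable to `τ`, the reciprocals of these
bounds form a divergent series in `τ`: they dominate the increments of the `p`-th iterated
logarithm. Hence a finite set of symbols `τ` already has reciprocal sum greater than `1`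
(`IsTractFamily.exists_alphabet`), and by continuity the sum of the `d`-th powers is at least `1`
for some `d > 1`.

Every sequence of symbols is realised by a point with bounded expanding orbit, which therefore lies
in the Julia set. Points whose symbols first differ at time `n` are at distance at least about the
inverse of the accumulated derivative (`IsAlphabet.one_le_mul_norm_sub`). Coding `[0,1)` by the
symbols then gives a `d`-Hölder map from a subset onto an interval, so the dimension is at least `d`
(`one_lt_dimH_of_coding`). -/

lemma expMap_ne_zero {lam : ℂ} (hlam : lam ≠ 0) (z : ℂ) : expMap lam z ≠ 0 :=
  mul_ne_zero hlam (Complex.exp_ne_zero z)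

lemma expMap_add (lam y a : ℂ) : expMap lam (y + a) = expMap lam y * Complex.exp a := by
  simp [expMap, Complex.exp_add, mul_assoc]

lemma continuous_expMap (lam : ℂ) : Continuous (expMap lam) := by
  unfold expMap; fun_prop

lemma differentiable_expMap (lam : ℂ) : Differentiable ℂ (expMap lam) := by
  unfold expMap; fun_prop

lemma deriv_expMap (lam z : ℂ) : deriv (expMap lam) z = expMap lam z := by
  unfold expMap; simp

lemma norm_expMap (lam z : ℂ) : ‖expMap lam z‖ = ‖lam‖ * Real.exp z.re := by
  simp [expMap, Complex.norm_exp]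

lemma re_eq_log {lam : ℂ} (hlam : lam ≠ 0) (z : ℂ) :
    z.re = Real.log ‖expMap lam z‖ - Real.log ‖lam‖ := by
  rw [norm_expMap, Real.log_mul (norm_ne_zero_iff.2 hlam) (Real.exp_ne_zero _), Real.log_exp]
  ring

lemma expMap_add_log {lam : ℂ} (hlam : lam ≠ 0) (y : ℂ) {x : ℂ}
    (hx : x / expMap lam y ∈ Complex.slitPlane) :
    expMap lam (y + Complex.log (x / expMap lam y)) = x := by
  rw [expMap_add, Complex.exp_log (Complex.slitPlane_ne_zero hx)]
  field_simp [expMap_ne_zero hlam y]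

lemma expMap_eq_iff {lam : ℂ} (hlam : lam ≠ 0) {a b : ℂ} :
    expMap lam a = expMap lam b ↔ ∃ n : ℤ, a = b + n * (2 * Real.pi * Complex.I) := by
  unfold expMap
  rw [mul_right_inj' hlam, Complex.exp_eq_exp_iff_exists_int]

lemma expMap_add_int (lam a : ℂ) (n : ℤ) :
    expMap lam (a + n * (2 * Real.pi * Complex.I)) = expMap lam a := by
  rw [expMap_add, Complex.exp_int_mul_two_pi_mul_I, mul_one]

lemma add_log_mem_component {lam : ℂ} (hlam : lam ≠ 0) {W S : Set ℂ} {y x : ℂ}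
    (hS : IsPreconnected S) (hSW : S ⊆ W) (hy : expMap lam y ∈ S)
    (hs : ∀ x ∈ S, x / expMap lam y ∈ Complex.slitPlane) (hx : x ∈ S) :
    y + Complex.log (x / expMap lam y) ∈ connectedComponentIn (expMap lam ⁻¹' W) y := by
  have hc : ContinuousOn (fun x => y + Complex.log (x / expMap lam y)) S :=
    continuousOn_const.add (ContinuousOn.clog (continuousOn_id.div_const _) hs)
  have h1 := hS.image _ hc
  refine h1.subset_connectedComponentIn (x := y) ⟨_, hy, ?_⟩ ?_ ⟨x, hx, rfl⟩
  · simp [div_self (expMap_ne_zero hlam y)]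
  · rintro _ ⟨x, hx, rfl⟩
    exact hSW (by rw [expMap_add_log hlam y (hs x hx)]; exact hx)

lemma div_mem_slitPlane {x w : ℂ} (hw : w ≠ 0) (h : ‖x - w‖ < ‖w‖) :
    x / w ∈ Complex.slitPlane := by
  apply Complex.ball_one_subset_slitPlane
  rw [Metric.mem_ball, dist_eq_norm, div_sub_one hw, norm_div, div_lt_one (norm_pos_iff.2 hw)]
  exact h

/-- With `3 * r ≤ ‖w‖` any two points of the ball have quotient in the slit plane, so the principal
logarithm lifts the whole ball starting at `k`. As the radius depends only on `w`, this makes images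
of components open and also relatively closed away from `0`. -/
lemma ball_subset_image_component {lam : ℂ} (hlam : lam ≠ 0) {W : Set ℂ} {y w k : ℂ} {r : ℝ}
    (hk : k ∈ connectedComponentIn (expMap lam ⁻¹' W) y) (hB : Metric.ball w r ⊆ W)
    (hkw : expMap lam k ∈ Metric.ball w r) (hr : 3 * r ≤ ‖w‖) :
    Metric.ball w r ⊆ expMap lam '' connectedComponentIn (expMap lam ⁻¹' W) y := by
  intro x hx
  have hsl : ∀ x ∈ Metric.ball w r, x / expMap lam k ∈ Complex.slitPlane := by
    intro x hx
    apply div_mem_slitPlane (expMap_ne_zero hlam k)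
    rw [Metric.mem_ball, dist_eq_norm] at hx hkw
    have h1 : ‖x - expMap lam k‖ ≤ ‖x - w‖ + ‖expMap lam k - w‖ := by
      rw [norm_sub_rev (expMap lam k)]; exact norm_sub_le_norm_sub_add_norm_sub _ _ _
    have h2 : ‖w‖ ≤ ‖expMap lam k‖ + ‖expMap lam k - w‖ := by
      have := norm_sub_norm_le w (expMap lam k)
      rw [norm_sub_rev] at this; linarith
    linarith
  refine ⟨_, ?_, expMap_add_log hlam k (hsl x hx)⟩
  rw [connectedComponentIn_eq hk]
  exact add_log_mem_component hlam (convex_ball w r).isPreconnected hB hkw hsl hx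

lemma isOpen_image_component {lam : ℂ} (hlam : lam ≠ 0) {W : Set ℂ} (hW : IsOpen W) (y : ℂ) :
    IsOpen (expMap lam '' connectedComponentIn (expMap lam ⁻¹' W) y) := by
  rw [Metric.isOpen_iff]
  rintro _ ⟨k, hk, rfl⟩
  have hkW : expMap lam k ∈ W := connectedComponentIn_subset (expMap lam ⁻¹' W) y hk
  obtain ⟨r, hr, hB⟩ := Metric.isOpen_iff.1 hW _ hkW
  have hn : 0 < ‖expMap lam k‖ := norm_pos_iff.2 (expMap_ne_zero hlam k)
  have hm : 0 < min r (‖expMap lam k‖ / 3) := lt_min hr (by positivity)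
  refine ⟨min r (‖expMap lam k‖ / 3), hm, ?_⟩
  refine ball_subset_image_component hlam hk ((Metric.ball_subset_ball (min_le_left _ _)).trans hB)
    (Metric.mem_ball_self hm) ?_
  have := min_le_right r (‖expMap lam k‖ / 3)
  linarith

lemma closure_image_component {lam : ℂ} (hlam : lam ≠ 0) {W : Set ℂ} (hW : IsOpen W) (y w : ℂ)
    (hw : w ∈ closure (expMap lam '' connectedComponentIn (expMap lam ⁻¹' W) y))
    (hwW : w ∈ W) (hw0 : w ≠ 0) :
    w ∈ expMap lam '' connectedComponentIn (expMap lam ⁻¹' W) y := by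
  obtain ⟨r, hr, hB⟩ := Metric.isOpen_iff.1 hW _ hwW
  have hn : 0 < ‖w‖ := norm_pos_iff.2 hw0
  have hm : 0 < min r (‖w‖ / 3) := lt_min hr (by positivity)
  obtain ⟨_, ⟨k, hk, rfl⟩, hd⟩ := Metric.mem_closure_iff.1 hw _ hm
  refine ball_subset_image_component hlam hk ((Metric.ball_subset_ball (min_le_left _ _)).trans hB)
    (by rwa [Metric.mem_ball, dist_comm]) ?_ (Metric.mem_ball_self hm)
  have := min_le_right r (‖w‖ / 3)
  linarith

/-- A component of the preimage of a domain omitting `0` maps onto the domain. -/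
lemma subset_image_component {lam : ℂ} (hlam : lam ≠ 0) {W : Set ℂ} (hW : IsOpen W)
    (hc : IsPreconnected W) (h0 : (0 : ℂ) ∉ W) {y : ℂ} (hy : expMap lam y ∈ W) :
    W ⊆ expMap lam '' connectedComponentIn (expMap lam ⁻¹' W) y :=
  hc.subset_of_closure_inter_subset (isOpen_image_component hlam hW y)
    ⟨_, hy, y, mem_connectedComponentIn (F := expMap lam ⁻¹' W) hy, rfl⟩
    fun w hw => closure_image_component hlam hW y w hw.1 hw.2 fun h => h0 (h ▸ hw.2)

/-- The preimage of a domain containing `0` is connected. -/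
lemma component_preimage_eq {lam : ℂ} (hlam : lam ≠ 0) {W : Set ℂ} (hW : IsOpen W)
    (hc : IsPreconnected W) (h0 : (0 : ℂ) ∈ W) {y : ℂ} (hy : expMap lam y ∈ W) :
    connectedComponentIn (expMap lam ⁻¹' W) y = expMap lam ⁻¹' W := by
  obtain ⟨r, hr, hB⟩ := Metric.isOpen_iff.1 hW _ h0
  have hlp : 0 < ‖lam‖ := norm_pos_iff.2 hlam
  have hhalf : expMap lam ⁻¹' Metric.ball 0 r = {z | z.re < Real.log (r / ‖lam‖)} := by
    ext z
    rw [mem_preimage, mem_ball_zero_iff, norm_expMap, mem_ofPred_eq,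
      Real.lt_log_iff_exp_lt (by positivity), lt_div_iff₀ hlp, mul_comm]
  have hpc : IsPreconnected (expMap lam ⁻¹' Metric.ball 0 r) := by
    rw [hhalf]
    exact (convex_halfSpace_re_lt _).isPreconnected
  -- If a component missed the half-plane over the ball, its image would be open, relatively closed
  -- in `W` and away from `0`, hence would cover `W`; but `f` omits `0`. So all components contain
  -- points of one connected half-plane and coincide.
  have hmeet : ∀ y, expMap lam y ∈ W → ∃ k ∈ connectedComponentIn (expMap lam ⁻¹' W) y,
      expMap lam k ∈ Metric.ball 0 r := by
    intro y hy
    by_contra! hcon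
    have hdis : Disjoint (Metric.ball 0 r)
        (expMap lam '' connectedComponentIn (expMap lam ⁻¹' W) y) := by
      rw [Set.disjoint_left]
      rintro _ hx ⟨k, hk, rfl⟩
      exact hcon k hk hx
    have := hc.subset_of_closure_inter_subset (isOpen_image_component hlam hW y)
      ⟨_, hy, y, mem_connectedComponentIn (F := expMap lam ⁻¹' W) hy, rfl⟩
      fun w hw => closure_image_component hlam hW y w hw.1 hw.2 fun h => by
        have h2 := hdis.closure_right Metric.isOpen_ball
        exact Set.disjoint_left.1 h2 (Metric.mem_ball_self hr) (h ▸ hw.1)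
    obtain ⟨k, -, hk⟩ := this h0
    exact expMap_ne_zero hlam k hk
  refine (connectedComponentIn_subset _ _).antisymm fun x hx => ?_
  obtain ⟨k, hk, hkr⟩ := hmeet y hy
  obtain ⟨k', hk', hkr'⟩ := hmeet x hx
  have h1 := hpc.subset_connectedComponentIn hkr (preimage_mono hB) hkr'
  rw [← connectedComponentIn_eq hk] at h1
  rw [connectedComponentIn_eq h1, ← connectedComponentIn_eq hk']
  exact mem_connectedComponentIn (F := expMap lam ⁻¹' W) hx

/-! ### Components of preimages in terms of a branch of the inverse -/

/-- On the component, `(z - L (f z)) / (2πi)` is continuous and integer valued, hence constant. -/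
lemma component_eq_image_branch {lam : ℂ} (hlam : lam ≠ 0) {Ω W : Set ℂ} {L : ℂ → ℂ}
    (hL : ContinuousOn L Ω) (hLf : ∀ x ∈ Ω, expMap lam (L x) = x) (hWΩ : W ⊆ Ω)
    (hW : IsPreconnected W) {y : ℂ} (hy : expMap lam y ∈ W) :
    connectedComponentIn (expMap lam ⁻¹' W) y
      = (fun x => L x + (y - L (expMap lam y))) '' W := by
  have hexp : ∀ x ∈ Ω, expMap lam (L x + (y - L (expMap lam y))) = x := by
    intro x hx
    obtain ⟨n, hn⟩ := (expMap_eq_iff hlam).1 (hLf _ (hWΩ hy)).symm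
    have : y - L (expMap lam y) = n * (2 * Real.pi * Complex.I) := by
      rw [sub_eq_iff_eq_add']; exact hn
    rw [this, expMap_add_int, hLf x hx]
  apply Subset.antisymm
  · intro k hk
    have hK : IsPreconnected (connectedComponentIn (expMap lam ⁻¹' W) y) :=
      isPreconnected_connectedComponentIn
    have hsub : connectedComponentIn (expMap lam ⁻¹' W) y ⊆ expMap lam ⁻¹' W :=
      connectedComponentIn_subset _ _
    have hcont : ContinuousOn (fun z => ((z - L (expMap lam z)) / (2 * Real.pi * Complex.I)))
        (connectedComponentIn (expMap lam ⁻¹' W) y) := by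
      refine (continuousOn_id.sub (hL.comp (continuous_expMap lam).continuousOn ?_)).div_const _
      exact fun z hz => hWΩ (hsub hz)
    have hdisc : IsDiscrete (range ((↑) : ℤ → ℂ)) :=
      ⟨(Complex.isClosedEmbedding_intCast.isEmbedding.toHomeomorph.symm.isEmbedding.discreteTopology)⟩
    have := hK.constant_of_mapsTo hdisc hcont (fun z hz => by
      obtain ⟨n, hn⟩ := (expMap_eq_iff hlam).1 (hLf _ (hWΩ (hsub hz))).symm
      refine ⟨n, ?_⟩
      have h2 : z - L (expMap lam z) = n * (2 * Real.pi * Complex.I) := by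
        rw [sub_eq_iff_eq_add']; exact hn
      change (n : ℂ) = (z - L (expMap lam z)) / (2 * Real.pi * Complex.I)
      rw [h2, mul_div_cancel_right₀ _ Complex.two_pi_I_ne_zero]) hk
      (mem_connectedComponentIn (F := expMap lam ⁻¹' W) hy)
    rw [div_left_inj' Complex.two_pi_I_ne_zero] at this
    refine ⟨expMap lam k, hsub hk, ?_⟩
    change L (expMap lam k) + (y - L (expMap lam y)) = k
    rw [← this]; ring
  · have hc : ContinuousOn (fun x => L x + (y - L (expMap lam y))) W :=
      (hL.mono hWΩ).add continuousOn_const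
    refine (hW.image _ hc).subset_connectedComponentIn ⟨_, hy, by simp⟩ ?_
    rintro _ ⟨x, hx, rfl⟩
    rw [mem_preimage, hexp x (hWΩ hx)]
    exact hx

/-- A limit `y` of points of `G '' W` has `f y` in `closure W`, where `G` is continuous; passing to
the limit in `G (f z) = z` gives `y = G (f y)`. No point of the closure is lost at infinity or on
another branch. -/
lemma closure_image_branch {lam : ℂ} {Ω W : Set ℂ} {G : ℂ → ℂ}
    (hG : ContinuousOn G Ω) (hGf : ∀ x ∈ Ω, expMap lam (G x) = x) (hWΩ : closure W ⊆ Ω) :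
    closure (G '' W) = G '' closure W := by
  apply Subset.antisymm
  · intro y hy
    have hfy : expMap lam y ∈ closure W := by
      have := (continuous_expMap lam).continuousOn.image_closure (s := G '' W) ⟨y, hy, rfl⟩
      refine closure_mono ?_ this
      rintro _ ⟨_, ⟨x, hx, rfl⟩, rfl⟩
      rwa [hGf x (hWΩ (subset_closure hx))]
    refine ⟨_, hfy, ?_⟩
    have hnb : (𝓝[G '' W] y).NeBot := mem_closure_iff_nhdsWithin_neBot.1 hy
    have h1 : Tendsto (fun z => G (expMap lam z)) (𝓝[G '' W] y) (𝓝 (G (expMap lam y))) := by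
      refine Tendsto.comp (hG _ (hWΩ hfy)) ?_
      refine tendsto_nhdsWithin_iff.2 ⟨(continuous_expMap lam).continuousAt.mono_left
        nhdsWithin_le_nhds, ?_⟩
      filter_upwards [self_mem_nhdsWithin] with z hz
      obtain ⟨x, hx, rfl⟩ := hz
      rw [hGf x (hWΩ (subset_closure hx))]
      exact hWΩ (subset_closure hx)
    have h2 : Tendsto (fun z => G (expMap lam z)) (𝓝[G '' W] y) (𝓝 y) := by
      refine (tendsto_id.mono_left nhdsWithin_le_nhds : Tendsto id (𝓝[G '' W] y) (𝓝 y)).congr' ?_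
      filter_upwards [self_mem_nhdsWithin] with z hz
      obtain ⟨x, hx, rfl⟩ := hz
      rw [hGf x (hWΩ (subset_closure hx))]; rfl
    exact tendsto_nhds_unique h1 h2
  · exact (hG.mono hWΩ).image_closure

lemma frontier_image_branch {lam : ℂ} {Ω W : Set ℂ} {G : ℂ → ℂ}
    (hG : ContinuousOn G Ω) (hGf : ∀ x ∈ Ω, expMap lam (G x) = x) (hWΩ : closure W ⊆ Ω)
    (hW : IsOpen W) (hGW : IsOpen (G '' W)) :
    frontier (G '' W) = G '' frontier W := by
  rw [hW.frontier_eq, hGW.frontier_eq, closure_image_branch hG hGf hWΩ]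
  have hinj : InjOn G Ω := fun a ha b hb h => by rw [← hGf a ha, h, hGf b hb]
  rw [(hinj.mono hWΩ).image_sdiff_subset subset_closure]

/-- A closed set with connected boundary is connected. -/
lemma isPreconnected_of_frontier {A : Set ℂ} (hA : IsClosed A) (hne : A ≠ univ)
    (hf : IsPreconnected (frontier A)) : IsPreconnected A := by
  obtain ⟨b, hb⟩ := (Set.ne_univ_iff_exists_notMem A).1 hne
  -- Walk from `a` straight towards the outside point `b`; the segment up to the last parameter
  -- before leaving `A` joins `a` to the frontier inside `A`.
  have key : ∀ a ∈ A, ∃ t ⊆ A, IsPreconnected t ∧ a ∈ t ∧ (t ∩ frontier A).Nonempty := by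
    intro a ha
    let s : Set ℝ := {t | 0 ≤ t ∧ ∀ u ∈ Icc (0 : ℝ) t, AffineMap.lineMap a b u ∈ A}
    have hcont : Continuous (fun u : ℝ => AffineMap.lineMap a b u) :=
      AffineMap.lineMap_continuous
    have h0 : (0 : ℝ) ∈ s := ⟨le_rfl, fun u hu => by
      obtain rfl : u = 0 := le_antisymm hu.2 hu.1
      simpa using ha⟩
    have hb1 : ∀ t ∈ s, t ≤ 1 := fun t ht => by
      by_contra! h
      exact hb (by simpa using ht.2 1 ⟨zero_le_one, h.le⟩)
    have hbdd : BddAbove s := ⟨1, hb1⟩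
    set T := sSup s with hT
    have hT0 : 0 ≤ T := le_csSup hbdd h0
    have hlt : ∀ u ∈ Ico (0 : ℝ) T, AffineMap.lineMap a b u ∈ A := by
      intro u hu
      obtain ⟨t, ht, hut⟩ := exists_lt_of_lt_csSup ⟨0, h0⟩ hu.2
      exact ht.2 u ⟨hu.1, hut.le⟩
    have hTA : AffineMap.lineMap a b T ∈ A := by
      rcases hT0.eq_or_lt with h | h
      · rw [← h]; simpa using ha
      · have : T ∈ closure (Ico 0 T) := by rw [closure_Ico h.ne]; exact ⟨hT0, le_rfl⟩
        exact hA.closure_subset_iff.2 (image_subset_iff.2 hlt)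
          (hcont.continuousOn.image_closure ⟨T, this, rfl⟩)
    have hTs : T ∈ s := ⟨hT0, fun u hu => by
      rcases hu.2.eq_or_lt with h | h
      · rw [h]; exact hTA
      · exact hlt u ⟨hu.1, h⟩⟩
    refine ⟨(fun u : ℝ => AffineMap.lineMap a b u) '' Icc 0 T, image_subset_iff.2 hTs.2,
      isPreconnected_Icc.image _ hcont.continuousOn, ⟨0, ⟨le_rfl, hT0⟩, by simp⟩,
      _, ⟨T, ⟨hT0, le_rfl⟩, rfl⟩, ?_⟩
    rw [hA.frontier_eq]
    refine ⟨hTA, fun hint => ?_⟩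
    have hnb : ∀ᶠ u in 𝓝 T, AffineMap.lineMap a b u ∈ A :=
      hcont.continuousAt (mem_interior_iff_mem_nhds.1 hint)
    obtain ⟨ε, hε, hball⟩ := Metric.eventually_nhds_iff.1 hnb
    have : T + ε / 2 ∈ s := ⟨by linarith, fun u hu => by
      rcases le_or_gt u T with h | h
      · exact hTs.2 u ⟨hu.1, h⟩
      · apply hball
        rw [Real.dist_eq, abs_of_pos (by linarith)]
        linarith [hu.2]⟩
    linarith [le_csSup hbdd this]
  rcases (frontier A).eq_empty_or_nonempty with h | ⟨x₀, hx₀⟩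
  · rcases A.eq_empty_or_nonempty with hA0 | ⟨a, ha⟩
    · rw [hA0]; exact isPreconnected_empty
    · obtain ⟨t, -, -, -, h1⟩ := key a ha
      rw [h] at h1; simp at h1
  · refine isPreconnected_of_forall x₀ fun a ha => ?_
    obtain ⟨t, htA, htc, hat, z, hzt, hzf⟩ := key a ha
    exact ⟨t ∪ frontier A, union_subset htA hA.frontier_subset, Or.inr hx₀, Or.inl hat,
      IsPreconnected.union z hzt hzf htc hf⟩


/-! ### Logarithms with bounded imaginary part -/

/-- There is a continuous branch of `log (x - a)` on `Ω` whose imaginary part is bounded. -/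
def HasBoundedLog (Ω : Set ℂ) (a : ℂ) : Prop :=
  ∃ l : ℂ → ℂ, ContinuousOn l Ω ∧ (∀ x ∈ Ω, Complex.exp (l x) = x - a) ∧
    ∃ B : ℝ, ∀ x ∈ Ω, |(l x).im| ≤ B

/-- The quotient `(x - b) / (x - a)` stays within distance `1` of `1`, so its principal logarithm is
a correction of imaginary part at most `π`. -/
lemma HasBoundedLog.of_ball {Ω : Set ℂ} {a b : ℂ} {r : ℝ} (h : HasBoundedLog Ω a)
    (hr : Disjoint (Metric.ball a r) Ω) (hb : dist b a < r) : HasBoundedLog Ω b := by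
  obtain ⟨l, hc, he, B, hB⟩ := h
  have hxa : ∀ x ∈ Ω, r ≤ ‖x - a‖ := by
    intro x hx
    by_contra! h
    exact Set.disjoint_left.1 hr (by rwa [Metric.mem_ball, dist_eq_norm]) hx
  have hne : ∀ x ∈ Ω, x - a ≠ 0 := fun x hx => by
    rw [← he x hx]; exact Complex.exp_ne_zero _
  have hs : ∀ x ∈ Ω, (x - b) / (x - a) ∈ Complex.slitPlane := by
    intro x hx
    apply div_mem_slitPlane (hne x hx)
    rw [sub_sub_sub_cancel_left, norm_sub_rev, ← dist_eq_norm]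
    exact hb.trans_le (hxa x hx)
  refine ⟨fun x => l x + Complex.log ((x - b) / (x - a)), hc.add (ContinuousOn.clog
    (ContinuousOn.div (by fun_prop) (by fun_prop) hne) hs), ?_, B + Real.pi, ?_⟩
  · intro x hx
    rw [Complex.exp_add, he x hx, Complex.exp_log (Complex.slitPlane_ne_zero (hs x hx))]
    field_simp [hne x hx]
  · intro x hx
    rw [Complex.add_im]
    refine (abs_add_le _ _).trans (add_le_add (hB x hx) ?_)
    rw [Complex.log_im]
    exact Complex.abs_arg_le_pi _

/-- The admissible base points form a relatively clopen subset of `U`, because a base point can be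
moved within any disc in `U` centred at it. -/
lemma HasBoundedLog.of_mem {U : Set ℂ} (hU : IsOpen U) (hc : IsPreconnected U) {a b : ℂ}
    (ha : a ∈ U) (hb : b ∈ U) (h : HasBoundedLog Uᶜ a) : HasBoundedLog Uᶜ b := by
  have hsub : U ⊆ {x | x ∈ U ∧ HasBoundedLog Uᶜ x} := by
    refine hc.subset_of_closure_inter_subset ?_ ⟨a, ha, ha, h⟩ ?_
    · rw [Metric.isOpen_iff]
      rintro x ⟨hx, hxl⟩
      obtain ⟨r, hr, hB⟩ := Metric.isOpen_iff.1 hU x hx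
      exact ⟨r, hr, fun y hy => ⟨hB hy, hxl.of_ball (disjoint_compl_right_iff_subset.2 hB) hy⟩⟩
    · rintro x ⟨hx, hxU⟩
      obtain ⟨r, hr, hB⟩ := Metric.isOpen_iff.1 hU x hxU
      obtain ⟨y, ⟨hyU, hyl⟩, hd⟩ := Metric.mem_closure_iff.1 hx (r / 2) (by positivity)
      refine ⟨hxU, hyl.of_ball (r := r / 2) (disjoint_compl_right_iff_subset.2 ?_) hd⟩
      refine (Metric.ball_subset_ball' ?_).trans hB
      rw [dist_comm y x]; linarith
  exact (hsub hb).2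

lemma div_mem_slitPlane_of_re_pos {z w : ℂ} (hz : 0 < z.re) (hw : 0 < w.re) :
    z / w ∈ Complex.slitPlane := by
  have hw0 : w ≠ 0 := fun h => by simp [h] at hw
  have hn : 0 < Complex.normSq w := Complex.normSq_pos.2 hw0
  rw [Complex.mem_slitPlane_iff, Complex.div_re, Complex.div_im]
  by_contra! h
  obtain ⟨h1, h2⟩ := h
  rw [← add_div, div_le_iff₀ hn, zero_mul] at h1
  rw [← sub_div, div_eq_zero_iff, or_iff_left hn.ne'] at h2
  have h3 : (z.re * w.re + z.im * w.im) * w.re = z.re * (w.re ^ 2 + w.im ^ 2) := by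
    linear_combination w.im * h2
  have h4 : 0 < z.re * (w.re ^ 2 + w.im ^ 2) := by positivity
  nlinarith

/-- Off a curve that is a graph over a right half-line there is a logarithm with bounded imaginary
part, based at the end of the curve. -/
lemma hasBoundedLog_of_graph {Ω : Set ℂ} {Γ : ℝ → ℂ} {T : ℝ}
    (hΓ : ContinuousOn Γ (Ici T)) (hm : StrictMonoOn (fun t => (Γ t).re) (Ici T))
    (ht : Tendsto (fun t => (Γ t).re) atTop atTop) (hΩ : ∀ t, T ≤ t → Γ t ∉ Ω) :
    HasBoundedLog Ω (Γ T) := by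
  -- The real part of the curve, continued with slope `1` to the left of `T` so as to become a
  -- homeomorphism of the line. This extends the curve by a horizontal ray to a full graph `η`.
  set φ : ℝ → ℝ := fun t => (Γ (max t T)).re + min (t - T) 0 with hφ
  have hmax : Continuous fun t : ℝ => Γ (max t T) :=
    hΓ.comp_continuous (by fun_prop) fun t => mem_Ici.2 (le_max_right _ _)
  have hφc : Continuous φ := (Complex.continuous_re.comp hmax).add (by fun_prop)
  have hφm : StrictMono φ := by
    intro s t hst
    rcases le_or_gt T s with h | h
    · have := hm (show s ∈ Ici T from h) (show t ∈ Ici T from h.trans hst.le) hst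
      simp only [hφ, max_eq_left h, max_eq_left (h.trans hst.le)]
      rw [min_eq_right (by linarith), min_eq_right (by linarith)]
      simpa using this
    · have h1 : (Γ (max s T)).re ≤ (Γ (max t T)).re :=
        hm.monotoneOn (le_max_right s T) (le_max_right t T) (max_le_max_right T hst.le)
      have h2 : min (s - T) 0 < min (t - T) 0 := by
        rw [min_eq_left (by linarith)]
        exact lt_min (by linarith) (by linarith)
      exact add_lt_add_of_le_of_lt h1 h2
  have hφtop : Tendsto φ atTop atTop := by
    refine ht.congr' ?_
    filter_upwards [eventually_ge_atTop T] with t h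
    simp only [hφ, max_eq_left h]
    rw [min_eq_right (by linarith), add_zero]
  have hφbot : Tendsto φ atBot atBot := by
    have : Tendsto (fun t : ℝ => (Γ T).re - T + t) atBot atBot :=
      tendsto_atBot_add_const_left _ _ tendsto_id
    refine this.congr' ?_
    filter_upwards [eventually_le_atBot T] with t h
    simp only [hφ, max_eq_right h]
    rw [min_eq_left (by linarith)]
    ring
  have hφs : Function.Surjective φ := hφc.surjective hφtop hφbot
  set e := hφm.orderIsoOfSurjective φ hφs with he
  have heφ : ∀ t, e t = φ t := fun t => rfl
  set η : ℝ → ℝ := fun u => (Γ (max (e.symm u) T)).im with hη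
  have hηc : Continuous η := Complex.continuous_im.comp (hmax.comp e.symm.continuous)
  set a := Γ T with ha
  have hφT : φ T = a.re := by simp [hφ, ha]
  -- A vertical shear that carries `a` to `0` and the curve to the positive real axis; on `Ω` it
  -- therefore avoids `[0, ∞)`.
  set Φ : ℂ → ℂ := fun x => ⟨x.re - a.re, x.im - η x.re⟩ with hΦ
  have hΦc : Continuous Φ := by
    have : Φ = fun x : ℂ => ((x.re - a.re : ℝ) : ℂ) + ((x.im - η x.re : ℝ) : ℂ) * Complex.I := by
      funext x
      apply Complex.ext <;> simp [hΦ]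
    rw [this]
    have h1 : Continuous fun x : ℂ => η x.re := hηc.comp Complex.continuous_re
    fun_prop
  have hleft : ∀ x : ℂ, x.re ≤ a.re → Φ x = x - a := by
    intro x hx
    have : e.symm x.re ≤ T := by
      rw [OrderIso.symm_apply_le, heφ, hφT]; exact hx
    simp only [hΦ, hη, max_eq_right this]
    apply Complex.ext <;> simp [ha]
  have hright : ∀ x : ℂ, a.re ≤ x.re → (Φ x).im = 0 → ∃ t, T ≤ t ∧ Γ t = x := by
    intro x hx hi
    have h1 : T ≤ e.symm x.re := by
      rw [OrderIso.le_symm_apply, heφ, hφT]; exact hx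
    refine ⟨e.symm x.re, h1, ?_⟩
    simp only [hΦ, hη, max_eq_left h1] at hi
    have h2 : φ (e.symm x.re) = x.re := e.apply_symm_apply x.re
    simp only [hφ, max_eq_left h1] at h2
    rw [min_eq_right (by linarith), add_zero] at h2
    exact Complex.ext h2 (by linarith)
  have hs1 : ∀ x ∈ Ω, -Φ x ∈ Complex.slitPlane := by
    intro x hx
    rw [Complex.mem_slitPlane_iff]
    by_contra! h
    simp only [Complex.neg_re, Complex.neg_im, neg_eq_zero] at h
    obtain ⟨t, ht, hxt⟩ := hright x (by have := h.1; simp only [hΦ] at this; linarith) h.2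
    exact hΩ t ht (hxt ▸ hx)
  have hΦ0 : ∀ x ∈ Ω, Φ x ≠ 0 := fun x hx h =>
    Complex.slitPlane_ne_zero (hs1 x hx) (by rw [h, neg_zero])
  have hs2 : ∀ x ∈ Ω, (x - a) / Φ x ∈ Complex.slitPlane := by
    intro x hx
    rcases le_or_gt x.re a.re with h | h
    · rw [← hleft x h, div_self (hΦ0 x hx)]; exact Complex.one_mem_slitPlane
    · exact div_mem_slitPlane_of_re_pos (by simpa using h) (by simpa [hΦ] using h)
  -- Write `x - a` as `((x - a) / Φ x) · (-Φ x) · (-1)`. The first two factors lie in the slit plane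
  -- and `πi` is a logarithm of `-1`.
  refine ⟨fun x => Complex.log ((x - a) / Φ x) + Complex.log (-Φ x) + Real.pi * Complex.I,
    ((ContinuousOn.clog (ContinuousOn.div (by fun_prop) hΦc.continuousOn hΦ0) hs2).add
      (ContinuousOn.clog hΦc.neg.continuousOn hs1)).add continuousOn_const, ?_,
    Real.pi + Real.pi + Real.pi, ?_⟩
  · intro x hx
    rw [Complex.exp_add, Complex.exp_add, Complex.exp_pi_mul_I,
      Complex.exp_log (Complex.slitPlane_ne_zero (hs2 x hx)),
      Complex.exp_log (Complex.slitPlane_ne_zero (hs1 x hx))]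
    field_simp [hΦ0 x hx]
  · intro x hx
    rw [Complex.add_im, Complex.add_im, Complex.log_im, Complex.log_im]
    refine (abs_add_le _ _).trans (add_le_add ((abs_add_le _ _).trans
      (add_le_add (Complex.abs_arg_le_pi _) (Complex.abs_arg_le_pi _))) ?_)
    simp [abs_of_pos Real.pi_pos]

/-! ### Curves to infinity -/

/-- `S` contains the end of a smooth curve to infinity, along which both the position and the
velocity have the limiting direction `u`. -/
def HasTail (S : Set ℂ) (u : ℂ) : Prop :=
  ∃ Γ Γ' : ℝ → ℂ, (∀ᶠ t in atTop, Γ t ∈ S ∧ HasDerivAt Γ (Γ' t) t ∧ Γ' t ≠ 0) ∧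
    Tendsto (fun t => Γ t / ‖Γ t‖) atTop (𝓝 u) ∧ Tendsto (fun t => Γ' t / ‖Γ' t‖) atTop (𝓝 u) ∧
    Tendsto (fun t => ‖Γ t‖) atTop atTop

lemma tendsto_div_norm_one {α : Type*} {l : Filter α} {z : α → ℂ} {B : ℝ}
    (hre : Tendsto (fun t => (z t).re) l atTop) (him : ∀ t, |(z t).im| ≤ B) :
    Tendsto (fun t => z t / ‖z t‖) l (𝓝 1) := by
  have h1 : Tendsto (fun t => z t / ((z t).re : ℂ)) l (𝓝 1) := by
    have h0 : Tendsto (fun t => B / (z t).re) l (𝓝 0) := hre.const_div_atTop B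
    rw [tendsto_iff_norm_sub_tendsto_zero]
    refine squeeze_zero' (Eventually.of_forall fun t => norm_nonneg _) ?_ h0
    filter_upwards [hre.eventually_gt_atTop 0] with t ht
    have hne : ((z t).re : ℂ) ≠ 0 := by exact_mod_cast ht.ne'
    have : z t - ((z t).re : ℂ) = (z t).im * Complex.I := by
      apply Complex.ext <;> simp
    rw [div_sub_one hne, norm_div, this, norm_mul, Complex.norm_I, mul_one, Complex.norm_real,
      Complex.norm_real, Real.norm_eq_abs, Real.norm_of_nonneg ht.le]
    gcongr
    exact him t
  have h2 := h1.norm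
  rw [norm_one] at h2
  have h3 : Tendsto (fun t => ((‖z t / ((z t).re : ℂ)‖ : ℝ) : ℂ)) l (𝓝 1) := by
    have := (Complex.continuous_ofReal.tendsto 1).comp h2
    rwa [Complex.ofReal_one] at this
  have h4 := h1.div h3 one_ne_zero
  rw [div_one] at h4
  refine h4.congr' ?_
  filter_upwards [hre.eventually_gt_atTop 0] with t ht
  have hne : ((z t).re : ℂ) ≠ 0 := by exact_mod_cast ht.ne'
  simp only [Pi.div_apply, norm_div, Complex.norm_real, Real.norm_of_nonneg ht.le, Complex.ofReal_div]
  rw [div_div_div_cancel_right₀ hne]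

lemma hasTail_of_halfPlane {S : Set ℂ} {c : ℝ} (h : {z : ℂ | z.re < c} ⊆ S) : HasTail S (-1) := by
  refine ⟨fun t => -(t : ℂ), fun _ => -1, ?_, ?_, ?_, ?_⟩
  · filter_upwards [eventually_gt_atTop (-c)] with t ht
    refine ⟨h (by simp; linarith), ?_, by simp⟩
    exact (HasDerivAt.ofReal_comp (hasDerivAt_id t)).neg
  · refine tendsto_const_nhds.congr' ?_
    filter_upwards [eventually_gt_atTop 0] with t ht
    have : (t : ℂ) ≠ 0 := by exact_mod_cast ht.ne'
    simp [abs_of_pos ht, neg_div, div_self this]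
  · simp
  · simp only [norm_neg, Complex.norm_real, Real.norm_eq_abs]
    exact tendsto_abs_atTop_atTop

/-- A logarithm of the curve has real part tending to infinity and bounded imaginary part, hence
limiting direction `1`. Its velocity `Γ' / Γ` has limiting direction `u / u = 1`. -/
lemma HasTail.component {lam : ℂ} (hlam : lam ≠ 0) {W : Set ℂ} {u y : ℂ} (h : HasTail W u)
    (hW : IsOpen W) (hc : IsPreconnected W) (h0 : (0 : ℂ) ∉ W) (hy : expMap lam y ∈ W) :
    HasTail (connectedComponentIn (expMap lam ⁻¹' W) y) 1 := by
  obtain ⟨Γ, Γ', hev, hd, hd', hn⟩ := h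
  have hu : ‖u‖ = 1 := by
    refine tendsto_nhds_unique hd.norm (tendsto_const_nhds.congr' ?_)
    filter_upwards [hn.eventually_gt_atTop 0] with t ht
    rw [norm_div, Complex.norm_real, norm_norm, div_self ht.ne']
  have hu0 : u ≠ 0 := fun h => by simp [h] at hu
  -- Directions within `1 / 2` of `u` are within `1` of each other, so `Γ t / Γ T` stays in the slit
  -- plane and the principal logarithm lifts the whole end of the curve.
  have hclose : ∀ᶠ t in atTop, dist (Γ t / ‖Γ t‖) u < 1 / 2 :=
    hd.eventually (Metric.ball_mem_nhds u (by norm_num))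
  obtain ⟨T, hT⟩ := (eventually_atTop.1 (hev.and hclose))
  obtain ⟨k, hk, hkT⟩ := subset_image_component hlam hW hc h0 hy (hT T le_rfl).1.1
  have hΓ0 : ∀ t, T ≤ t → Γ t ≠ 0 := fun t ht h => h0 (h ▸ (hT t ht).1.1)
  have hslit : ∀ t, T ≤ t → Γ t / Γ T ∈ Complex.slitPlane := by
    intro t ht
    have hp : 0 < ‖Γ t‖ := norm_pos_iff.2 (hΓ0 t ht)
    have hpT : 0 < ‖Γ T‖ := norm_pos_iff.2 (hΓ0 T le_rfl)
    have hpc : (‖Γ t‖ : ℂ) ≠ 0 := by exact_mod_cast hp.ne'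
    have hpTc : (‖Γ T‖ : ℂ) ≠ 0 := by exact_mod_cast hpT.ne'
    have hv : ‖Γ T / ‖Γ T‖‖ = 1 := by
      rw [norm_div, Complex.norm_real, norm_norm, div_self hpT.ne']
    have h1 : (Γ t / ‖Γ t‖) / (Γ T / ‖Γ T‖) ∈ Complex.slitPlane := by
      apply div_mem_slitPlane (norm_pos_iff.1 (by rw [hv]; exact one_pos))
      rw [hv, ← dist_eq_norm]
      have := dist_triangle_right (Γ t / ‖Γ t‖) (Γ T / ‖Γ T‖) u
      linarith [(hT t ht).2, (hT T le_rfl).2]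
    have h2 : Γ t / Γ T = ((‖Γ t‖ / ‖Γ T‖ : ℝ) : ℂ) * ((Γ t / ‖Γ t‖) / (Γ T / ‖Γ T‖)) := by
      rw [Complex.ofReal_div]
      field_simp [hΓ0 T le_rfl]
    rw [h2]
    have h3 : 0 < ‖Γ t‖ / ‖Γ T‖ := div_pos hp hpT
    rw [Complex.mem_slitPlane_iff] at h1 ⊢
    rw [Complex.re_ofReal_mul, Complex.im_ofReal_mul]
    exact h1.imp (fun h => mul_pos h3 h) (fun h => mul_ne_zero h3.ne' h)
  have hcont : ContinuousOn Γ (Ici T) := fun t ht =>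
    (hT t ht).1.2.1.continuousAt.continuousWithinAt
  set Γ₁ : ℝ → ℂ := fun t => k + Complex.log (Γ t / Γ T) with hΓ₁
  have hre : Tendsto (fun t => (Γ₁ t).re) atTop atTop := by
    simp only [hΓ₁, Complex.add_re, Complex.log_re, norm_div]
    refine tendsto_atTop_add_const_left _ _ (Real.tendsto_log_atTop.comp ?_)
    exact hn.atTop_div_const (norm_pos_iff.2 (hΓ0 T le_rfl))
  have him : ∀ t, |(Γ₁ t).im| ≤ |k.im| + Real.pi := by
    intro t
    simp only [hΓ₁, Complex.add_im, Complex.log_im]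
    exact (abs_add_le _ _).trans (add_le_add le_rfl (Complex.abs_arg_le_pi _))
  refine ⟨Γ₁, fun t => Γ' t / Γ t, ?_, tendsto_div_norm_one hre him, ?_, ?_⟩
  · filter_upwards [eventually_ge_atTop T] with t ht
    refine ⟨?_, ?_, div_ne_zero (hT t ht).1.2.2 (hΓ0 t ht)⟩
    · rw [connectedComponentIn_eq hk]
      have hpre : IsPreconnected (Γ '' Ici T) := isPreconnected_Ici.image _ hcont
      have := add_log_mem_component hlam (W := W) (S := Γ '' Ici T) (y := k) (x := Γ t) hpre
        (by rintro _ ⟨s, hs, rfl⟩; exact (hT s hs).1.1) (by rw [hkT]; exact ⟨T, self_mem_Ici, rfl⟩)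
        (by rintro _ ⟨s, hs, rfl⟩; rw [hkT]; exact hslit s hs) ⟨t, ht, rfl⟩
      rwa [hkT] at this
    · have h1 := (((hT t ht).1.2.1.div_const (Γ T)).clog_real (hslit t ht)).const_add k
      rwa [div_div_div_cancel_right₀ (hΓ0 T le_rfl)] at h1
  · have h1 := hd'.div hd hu0
    rw [div_self hu0] at h1
    refine h1.congr' ?_
    filter_upwards [eventually_ge_atTop T] with t ht
    have hp : (‖Γ t‖ : ℂ) ≠ 0 := by exact_mod_cast (norm_pos_iff.2 (hΓ0 t ht)).ne'
    have hp' : (‖Γ' t‖ : ℂ) ≠ 0 := by exact_mod_cast (norm_pos_iff.2 (hT t ht).1.2.2).ne'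
    simp only [Pi.div_apply, norm_div, Complex.ofReal_div]
    field_simp [hΓ0 t ht]
  · exact tendsto_atTop_mono (fun t => Complex.re_le_norm _) hre

/-- Velocity tending to the direction `1` makes the end of the curve a graph over a half-line, so
`hasBoundedLog_of_graph` applies at its starting point; the base point is then moved inside `U`. -/
lemma HasTail.hasBoundedLog {U : Set ℂ} (h : HasTail U 1) (hU : IsOpen U) (hc : IsPreconnected U)
    {b : ℂ} (hb : b ∈ U) : HasBoundedLog Uᶜ b := by
  obtain ⟨Γ, Γ', hev, hd, hd', hn⟩ := h
  have hpos : ∀ᶠ t in atTop, 0 < (Γ' t / ‖Γ' t‖).re :=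
    ((Complex.continuous_re.tendsto 1).comp hd').eventually (lt_mem_nhds (by simp))
  obtain ⟨T, hT⟩ := eventually_atTop.1 (hev.and hpos)
  have hre : Tendsto (fun t => (Γ t).re) atTop atTop := by
    have h1 := hn.atTop_mul_pos (C := (1 : ℂ).re) (by simp)
      ((Complex.continuous_re.tendsto 1).comp hd)
    refine h1.congr' ?_
    filter_upwards [hn.eventually_gt_atTop 0] with t ht
    simp only [Function.comp, Complex.div_ofReal_re]
    field_simp
  have hder : ∀ t, T ≤ t → HasDerivAt (fun t => (Γ t).re) (Γ' t).re t := fun t ht =>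
    (Complex.reCLM.hasFDerivAt.comp_hasDerivAt t (hT t ht).1.2.1)
  have hmono : StrictMonoOn (fun t => (Γ t).re) (Ici T) := by
    refine strictMonoOn_of_deriv_pos (convex_Ici T)
      (fun t ht => (hder t ht).continuousAt.continuousWithinAt) fun t ht => ?_
    rw [interior_Ici] at ht
    rw [(hder t (le_of_lt ht)).deriv]
    have h1 := (hT t (le_of_lt ht)).2
    rw [Complex.div_ofReal_re] at h1
    by_contra! h2
    exact absurd h1 (not_lt.2 (div_nonpos_of_nonpos_of_nonneg h2 (norm_nonneg _)))
  refine HasBoundedLog.of_mem hU hc (hT T le_rfl).1.1 hb (hasBoundedLog_of_graph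
    (fun t ht => (hT t ht).1.2.1.continuousAt.continuousWithinAt) hmono hre fun t ht => ?_)
  simpa using (hT t ht).1.1


/-! ### The basin of the cycle -/

/-- The points whose orbit under `f^p` converges to the point `z_j` of the cycle. -/
def basinAt (lam : ℂ) (p : ℕ) (z₀ : ℂ) (j : ℕ) : Set ℂ :=
  {z | Tendsto (fun n : ℕ => (expMap lam)^[n * p] z) atTop (𝓝 (cyclePt lam z₀ j))}

lemma continuous_iterate_expMap (lam : ℂ) (n : ℕ) : Continuous (expMap lam)^[n] :=
  (continuous_expMap lam).iterate n

lemma expMap_cyclePt (lam z₀ : ℂ) (j : ℕ) :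
    expMap lam (cyclePt lam z₀ j) = cyclePt lam z₀ (j + 1) :=
  (Function.iterate_succ_apply' _ _ _).symm

lemma iterate_cyclePt (lam z₀ : ℂ) (n j : ℕ) :
    (expMap lam)^[n] (cyclePt lam z₀ j) = cyclePt lam z₀ (n + j) :=
  (Function.iterate_add_apply _ _ _ _).symm

variable {lam z₀ : ℂ} {p : ℕ}

lemma IsAttractingCycle.isPeriodicPt (h : IsAttractingCycle lam p z₀) :
    (expMap lam)^[p] z₀ = z₀ := by
  rw [← h.minimalPeriod_eq]; exact Function.iterate_minimalPeriod

lemma IsAttractingCycle.cyclePt_self (h : IsAttractingCycle lam p z₀) :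
    cyclePt lam z₀ p = z₀ := h.isPeriodicPt

lemma IsAttractingCycle.cyclePt_add (h : IsAttractingCycle lam p z₀) (j : ℕ) :
    cyclePt lam z₀ (j + p) = cyclePt lam z₀ j := by
  rw [← iterate_cyclePt, h.cyclePt_self]; rfl

lemma IsAttractingCycle.iterate_mul_cyclePt (h : IsAttractingCycle lam p z₀) (n j : ℕ) :
    (expMap lam)^[n * p] (cyclePt lam z₀ j) = cyclePt lam z₀ j := by
  induction n with
  | zero => simp
  | succ n ih =>
    rw [Nat.succ_mul, Function.iterate_add_apply, iterate_cyclePt, Nat.add_comm p j,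
      h.cyclePt_add, ih]

lemma IsAttractingCycle.cyclePt_mem_basinAt (h : IsAttractingCycle lam p z₀) (j : ℕ) :
    cyclePt lam z₀ j ∈ basinAt lam p z₀ j := by
  simp only [basinAt, mem_ofPred_eq, h.iterate_mul_cyclePt]
  exact tendsto_const_nhds

lemma IsAttractingCycle.mem_basinAt_of_expMap (h : IsAttractingCycle lam p z₀) (hp : 1 ≤ p)
    {j : ℕ} {z : ℂ} (hz : expMap lam z ∈ basinAt lam p z₀ (j + 1)) : z ∈ basinAt lam p z₀ j := by
  have h1 := ((continuous_iterate_expMap lam (p - 1)).tendsto _).comp hz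
  rw [iterate_cyclePt, show p - 1 + (j + 1) = j + p by omega, h.cyclePt_add] at h1
  have h2 : Tendsto (fun n : ℕ => (expMap lam)^[(n + 1) * p] z) atTop (𝓝 (cyclePt lam z₀ j)) := by
    refine h1.congr fun n => ?_
    rw [Function.comp_apply, ← Function.iterate_succ_apply, ← Function.iterate_add_apply]
    congr 1
    rw [Nat.succ_mul]; omega
  exact (tendsto_add_atTop_iff_nat (f := fun n : ℕ => (expMap lam)^[n * p] z) 1).1 h2

lemma IsAttractingCycle.cyclePt_ne (h : IsAttractingCycle lam p z₀) {i j : ℕ} (hi : i < p)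
    (hj : j < p) (hij : i ≠ j) : cyclePt lam z₀ i ≠ cyclePt lam z₀ j := by
  intro he
  apply hij
  refine Function.iterate_injOn_Iio_minimalPeriod (f := expMap lam) (x := z₀) ?_ ?_ he
  · rw [h.minimalPeriod_eq]; exact hi
  · rw [h.minimalPeriod_eq]; exact hj

lemma disjoint_basinAt {i j : ℕ} (hij : cyclePt lam z₀ i ≠ cyclePt lam z₀ j) :
    Disjoint (basinAt lam p z₀ i) (basinAt lam p z₀ j) :=
  Set.disjoint_left.2 fun _ hi hj => hij (tendsto_nhds_unique hi hj)

lemma exists_nhds_iterate_tendsto {g : ℂ → ℂ} {z : ℂ} (hg : DifferentiableAt ℂ g z) (hz : g z = z)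
    (hd : ‖deriv g z‖ < 1) :
    ∃ r > 0, ∀ w ∈ Metric.ball z r, Tendsto (fun n => g^[n] w) atTop (𝓝 z) := by
  obtain ⟨c, hc1, hc2⟩ := exists_between hd
  have hc0 : 0 ≤ c := (norm_nonneg _).trans hc1.le
  have h1 : ∀ᶠ w in 𝓝[≠] z, ‖slope g z w‖ < c :=
    hg.hasDerivAt.tendsto_slope.norm.eventually (gt_mem_nhds hc1)
  obtain ⟨r, hr, hB⟩ := Metric.mem_nhdsWithin_iff.1 h1
  have key : ∀ w ∈ Metric.ball z r, ‖g w - z‖ ≤ c * ‖w - z‖ := by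
    intro w hw
    rcases eq_or_ne w z with rfl | hne
    · simp [hz]
    · have h2 : ‖slope g z w‖ < c := hB ⟨hw, hne⟩
      rw [slope_def_field, norm_div, hz, div_lt_iff₀ (norm_pos_iff.2 (sub_ne_zero.2 hne))] at h2
      exact h2.le
  refine ⟨r, hr, fun w hw => ?_⟩
  have h3 : ∀ n, ‖g^[n] w - z‖ ≤ c ^ n * ‖w - z‖ := by
    intro n
    induction n with
    | zero => simp
    | succ n ih =>
      have hin : g^[n] w ∈ Metric.ball z r := by
        rw [Metric.mem_ball, dist_eq_norm] at hw ⊢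
        refine lt_of_le_of_lt (ih.trans ?_) hw
        exact mul_le_of_le_one_left (norm_nonneg _) (pow_le_one₀ hc0 hc2.le)
      rw [Function.iterate_succ_apply', pow_succ', mul_assoc]
      exact (key _ hin).trans (mul_le_mul_of_nonneg_left ih hc0)
  rw [tendsto_iff_norm_sub_tendsto_zero]
  refine squeeze_zero (fun n => norm_nonneg _) h3 ?_
  simpa using (tendsto_pow_atTop_nhds_zero_of_lt_one hc0 hc2).mul_const ‖w - z‖

lemma IsAttractingCycle.isOpen_basinAt (h : IsAttractingCycle lam p z₀) {j : ℕ} (hj : j ≤ p) :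
    IsOpen (basinAt lam p z₀ j) := by
  obtain ⟨r, hr, hW⟩ := exists_nhds_iterate_tendsto
    ((differentiable_expMap lam).iterate p).differentiableAt h.isPeriodicPt h.attracting
  rw [isOpen_iff_mem_nhds]
  intro z hz
  have h1 := ((continuous_iterate_expMap lam (p - j)).tendsto _).comp hz
  rw [iterate_cyclePt, Nat.sub_add_cancel hj, h.cyclePt_self] at h1
  obtain ⟨n, hn⟩ := (h1.eventually (Metric.ball_mem_nhds z₀ hr)).exists
  rw [Function.comp_apply, ← Function.iterate_add_apply] at hn
  have h2 := (continuous_iterate_expMap lam (p - j + n * p)).continuousAt.preimage_mem_nhds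
    (Metric.isOpen_ball.mem_nhds hn)
  filter_upwards [h2] with w hw
  have h3 := ((continuous_iterate_expMap lam j).tendsto _).comp (hW _ hw)
  have h4 : Tendsto (fun i : ℕ => (expMap lam)^[(i + (n + 1)) * p] w) atTop
      (𝓝 (cyclePt lam z₀ j)) := by
    refine h3.congr fun i => ?_
    rw [Function.comp_apply, ← Function.iterate_mul, ← Function.iterate_add_apply,
      ← Function.iterate_add_apply]
    congr 1
    rw [Nat.add_mul, Nat.add_mul, Nat.mul_comm i p]
    omega
  exact (tendsto_add_atTop_iff_nat (f := fun n : ℕ => (expMap lam)^[n * p] w) (n + 1)).1 h4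

/-- The basin is a disjoint union of the open sets `basinAt`, one for each point of the cycle, and a
connected set meets only one of them. -/
lemma IsAttractingCycle.basinComp_subset (h : IsAttractingCycle lam p z₀) {j : ℕ} (hj : j < p) :
    basinComp lam p z₀ j ⊆ basinAt lam p z₀ j := by
  have hmem : cyclePt lam z₀ j ∈ basin lam p z₀ := ⟨j, hj, h.cyclePt_mem_basinAt j⟩
  have hV : IsOpen (⋃ i ∈ {i | i < p ∧ i ≠ j}, basinAt lam p z₀ i) :=
    isOpen_biUnion fun i hi => h.isOpen_basinAt hi.1.le
  refine isPreconnected_connectedComponentIn.subset_left_of_subset_union (h.isOpen_basinAt hj.le)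
    hV ?_ ?_ ⟨_, mem_connectedComponentIn hmem, h.cyclePt_mem_basinAt j⟩
  · simp only [disjoint_iUnion_right]
    exact fun i hi => disjoint_basinAt (h.cyclePt_ne hj hi.1 hi.2.symm)
  · refine (connectedComponentIn_subset _ _).trans ?_
    rintro z ⟨i, hi, hz⟩
    rcases eq_or_ne i j with rfl | hne
    · exact Or.inl hz
    · exact Or.inr (mem_biUnion (show i ∈ {i | i < p ∧ i ≠ j} from ⟨hi, hne⟩) hz)

lemma basinAt_subset_basin {j : ℕ} (hj : j < p) : basinAt lam p z₀ j ⊆ basin lam p z₀ :=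
  fun _ hz => ⟨j, hj, hz⟩

/-! ### The pull-backs of the truncated domain -/

lemma cSet_self (lam : ℂ) (p : ℕ) (z₀ : ℂ) (C : Set ℂ) : cSet lam p z₀ C p = C := by
  simp [cSet, pullback]

lemma cSet_of_lt (lam z₀ : ℂ) (C : Set ℂ) {p j : ℕ} (hj : j < p) :
    cSet lam p z₀ C j
      = connectedComponentIn (expMap lam ⁻¹' cSet lam p z₀ C (j + 1)) (cyclePt lam z₀ j) := by
  unfold cSet
  rw [show p - j = p - (j + 1) + 1 by omega, pullback,
    show p - (p - (j + 1) + 1) = j by omega]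

variable {C D : Set ℂ}

lemma cSet_subset_preimage {j : ℕ} (hj : j < p) :
    cSet lam p z₀ C j ⊆ expMap lam ⁻¹' cSet lam p z₀ C (j + 1) := by
  rw [cSet_of_lt lam z₀ C hj]; exact connectedComponentIn_subset _ _

lemma isOpen_cSet (hC : IsOpen C) {j : ℕ} (hj : j ≤ p) : IsOpen (cSet lam p z₀ C j) := by
  refine Nat.decreasingInduction' (P := fun j => IsOpen (cSet lam p z₀ C j))
    (fun k hk _ ih => ?_) hj (by rwa [cSet_self])
  rw [cSet_of_lt lam z₀ C hk]
  exact (ih.preimage (continuous_expMap lam)).connectedComponentIn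

lemma isPreconnected_cSet (hC : IsPreconnected C) {j : ℕ} (hj : j ≤ p) :
    IsPreconnected (cSet lam p z₀ C j) := by
  rcases hj.eq_or_lt with rfl | h
  · rwa [cSet_self]
  · rw [cSet_of_lt lam z₀ C h]; exact isPreconnected_connectedComponentIn

lemma IsAttractingCycle.cyclePt_mem_cSet (h : IsAttractingCycle lam p z₀) (hC : z₀ ∈ C) {j : ℕ}
    (hj : j ≤ p) : cyclePt lam z₀ j ∈ cSet lam p z₀ C j := by
  refine Nat.decreasingInduction' (P := fun j => cyclePt lam z₀ j ∈ cSet lam p z₀ C j)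
    (fun k hk _ ih => ?_) hj (by rwa [cSet_self, h.cyclePt_self])
  rw [cSet_of_lt lam z₀ C hk]
  refine mem_connectedComponentIn ?_
  rwa [mem_preimage, expMap_cyclePt]

lemma IsAttractingCycle.cSet_subset_basinAt (h : IsAttractingCycle lam p z₀) (hp : 2 ≤ p)
    (hD : IsInitialDomain lam p z₀ D) (hC : IsTruncatedDomain lam p z₀ D C) {j : ℕ} (hj : j ≤ p) :
    cSet lam p z₀ C j ⊆ basinAt lam p z₀ j := by
  refine Nat.decreasingInduction' (P := fun j => cSet lam p z₀ C j ⊆ basinAt lam p z₀ j)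
    (fun k hk _ ih z hz => ?_) hj fun z hz => ?_
  · exact h.mem_basinAt_of_expMap (by omega) (ih (cSet_subset_preimage hk hz))
  · rw [cSet_self] at hz
    have h1 : z ∈ basinAt lam p z₀ 0 := h.mem_basinAt_of_expMap (by omega)
      (h.basinComp_subset (by omega) (hD.subset_basinComp (hC.subset hz)))
    have h2 : cyclePt lam z₀ p = cyclePt lam z₀ 0 := h.cyclePt_self
    simpa only [basinAt, h2] using h1

lemma IsAttractingCycle.cSet_subset_basinComp (h : IsAttractingCycle lam p z₀) (hp : 2 ≤ p)
    (hD : IsInitialDomain lam p z₀ D) (hC : IsTruncatedDomain lam p z₀ D C) {j : ℕ} (hj : j < p) :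
    cSet lam p z₀ C j ⊆ basinComp lam p z₀ j :=
  (isPreconnected_cSet hC.isConnected.isPreconnected hj.le).subset_connectedComponentIn
    (h.cyclePt_mem_cSet hC.cyclePt_mem hj.le)
    ((h.cSet_subset_basinAt hp hD hC hj.le).trans (basinAt_subset_basin hj))

lemma IsAttractingCycle.disjoint_cSet (h : IsAttractingCycle lam p z₀) (hp : 2 ≤ p)
    (hD : IsInitialDomain lam p z₀ D) (hC : IsTruncatedDomain lam p z₀ D C) {j : ℕ} (hj1 : 1 < j)
    (hj : j ≤ p) : Disjoint (cSet lam p z₀ C 1) (cSet lam p z₀ C j) := by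
  refine (disjoint_basinAt (p := p) (i := 1) (j := j) ?_).mono
    (h.cSet_subset_basinAt hp hD hC (by omega)) (h.cSet_subset_basinAt hp hD hC hj)
  rcases hj.eq_or_lt with rfl | hlt
  · rw [h.cyclePt_self]
    exact h.cyclePt_ne (i := 1) (j := 0) (by omega) (by omega) (by omega)
  · exact h.cyclePt_ne (by omega) hlt (by omega)

lemma zero_mem_cSet_one (hD : IsInitialDomain lam p z₀ D)
    (hC : IsTruncatedDomain lam p z₀ D C) : (0 : ℂ) ∈ cSet lam p z₀ C 1 :=
  hC.closure_subset (subset_closure hD.zero_mem)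

/-- Start with the left half-plane in `C_p` and pull back. Down to `C_1` only logarithms of sets
omitting `0` occur, because `0 ∈ C_1` and `C_1` is disjoint from `C_2, …, C_p`. -/
lemma IsAttractingCycle.hasTail_cSet (h : IsAttractingCycle lam p z₀) (hlam : lam ≠ 0)
    (hp : 2 ≤ p) (hD : IsInitialDomain lam p z₀ D) (hC : IsTruncatedDomain lam p z₀ D C) :
    HasTail (cSet lam p z₀ C 1) 1 := by
  have step : ∀ j, 1 ≤ j → j < p → ∀ u, HasTail (cSet lam p z₀ C (j + 1)) u →
      HasTail (cSet lam p z₀ C j) 1 := by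
    intro j hj1 hj u hu
    rw [cSet_of_lt lam z₀ C hj]
    refine hu.component hlam (isOpen_cSet hC.isOpen hj)
      (isPreconnected_cSet hC.isConnected.isPreconnected hj) ?_ ?_
    · exact Set.disjoint_left.1 (h.disjoint_cSet hp hD hC (by omega) hj)
        (zero_mem_cSet_one hD hC)
    · rw [expMap_cyclePt]; exact h.cyclePt_mem_cSet hC.cyclePt_mem hj
  have h1 : ∃ u, HasTail (cSet lam p z₀ C 2) u := by
    refine Nat.decreasingInduction' (P := fun j => ∃ u, HasTail (cSet lam p z₀ C j) u)
      (fun k hk h2 ih => ⟨1, step k (by omega) hk _ ih.choose_spec⟩) hp ?_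
    obtain ⟨c, hc⟩ := hC.halfPlane
    rw [cSet_self]
    exact ⟨-1, hasTail_of_halfPlane hc⟩
  exact step 1 le_rfl (by omega) _ h1.choose_spec

/-- There is a branch of the inverse of `f` on the complement of `C_1`, with bounded imaginary
part. -/
lemma IsAttractingCycle.exists_branch (h : IsAttractingCycle lam p z₀) (hlam : lam ≠ 0)
    (hp : 2 ≤ p) (hD : IsInitialDomain lam p z₀ D) (hC : IsTruncatedDomain lam p z₀ D C) :
    ∃ L : ℂ → ℂ, ContinuousOn L (cSet lam p z₀ C 1)ᶜ ∧
      (∀ x ∈ (cSet lam p z₀ C 1)ᶜ, expMap lam (L x) = x) ∧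
      ∃ B : ℝ, ∀ x ∈ (cSet lam p z₀ C 1)ᶜ, |(L x).im| ≤ B := by
  obtain ⟨l, hc, he, B, hB⟩ := (h.hasTail_cSet hlam hp hD hC).hasBoundedLog
    (isOpen_cSet hC.isOpen (by omega))
    (isPreconnected_cSet hC.isConnected.isPreconnected (by omega)) (zero_mem_cSet_one hD hC)
  refine ⟨fun x => l x - Complex.log lam, hc.sub continuousOn_const, fun x hx => ?_,
    B + Real.pi, fun x hx => ?_⟩
  · rw [expMap, Complex.exp_sub, he x hx, Complex.exp_log hlam, sub_zero]
    field_simp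
  · rw [Complex.sub_im, Complex.log_im]
    exact (abs_sub _ _).trans (add_le_add (hB x hx) (Complex.abs_arg_le_pi _))

/-- The boundary of `C_p` is a curve, and each pull-back carries boundary onto boundary by a
continuous branch of the inverse. So the boundary of `C_1` is connected, and with it the closed
complement. -/
lemma IsAttractingCycle.isPreconnected_compl_cSet (h : IsAttractingCycle lam p z₀)
    (hlam : lam ≠ 0) (hp : 2 ≤ p) (hD : IsInitialDomain lam p z₀ D)
    (hC : IsTruncatedDomain lam p z₀ D C) : IsPreconnected (cSet lam p z₀ C 1)ᶜ := by
  obtain ⟨L, hL, hLf, -⟩ := h.exists_branch hlam hp hD hC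
  have hfr : IsPreconnected (frontier (cSet lam p z₀ C 1)) := by
    refine Nat.decreasingInduction' (P := fun j => IsPreconnected (frontier (cSet lam p z₀ C j)))
      (fun k hk h1 ih => ?_) (by omega : 1 ≤ p) ?_
    · have hcl : closure (cSet lam p z₀ C (k + 1)) ⊆ (cSet lam p z₀ C 1)ᶜ := by
        rw [← disjoint_compl_left_iff_subset, compl_compl]
        exact (h.disjoint_cSet hp hD hC (by omega) hk).closure_right
          (isOpen_cSet hC.isOpen (by omega))
      have hy : expMap lam (cyclePt lam z₀ k) ∈ cSet lam p z₀ C (k + 1) := by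
        rw [expMap_cyclePt]; exact h.cyclePt_mem_cSet hC.cyclePt_mem hk
      have heq := component_eq_image_branch hlam hL hLf (subset_closure.trans hcl)
        (isPreconnected_cSet hC.isConnected.isPreconnected hk) hy
      rw [← cSet_of_lt lam z₀ C hk] at heq
      set c := cyclePt lam z₀ k - L (expMap lam (cyclePt lam z₀ k))
      have hG : ContinuousOn (fun x => L x + c) (cSet lam p z₀ C 1)ᶜ := hL.add continuousOn_const
      have hGf : ∀ x ∈ (cSet lam p z₀ C 1)ᶜ, expMap lam (L x + c) = x := by
        intro x hx
        obtain ⟨n, hn⟩ := (expMap_eq_iff hlam).1 (hLf _ (hcl (subset_closure hy))).symm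
        have : c = n * (2 * Real.pi * Complex.I) := sub_eq_iff_eq_add'.2 hn
        rw [this, expMap_add_int, hLf x hx]
      have hop := isOpen_cSet (lam := lam) (z₀ := z₀) hC.isOpen hk.le
      rw [heq, frontier_image_branch hG hGf hcl (isOpen_cSet hC.isOpen hk) (heq ▸ hop)]
      exact ih.image _ (hG.mono (frontier_subset_closure.trans hcl))
    · obtain ⟨γ, hγ, -, hr, -⟩ := hC.curve
      rw [cSet_self, ← hr]
      exact isPreconnected_range hγ
  refine isPreconnected_of_frontier (isOpen_cSet hC.isOpen (by omega)).isClosed_compl ?_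
    (by rwa [frontier_compl])
  intro hu
  have := zero_mem_cSet_one hD hC
  rw [Set.compl_univ_iff] at hu
  rw [hu] at this
  exact this

lemma IsAttractingCycle.cSet_zero (h : IsAttractingCycle lam p z₀)
    (hlam : lam ≠ 0) (hp : 2 ≤ p) (hD : IsInitialDomain lam p z₀ D)
    (hC : IsTruncatedDomain lam p z₀ D C) :
    cSet lam p z₀ C 0 = expMap lam ⁻¹' cSet lam p z₀ C 1 := by
  rw [cSet_of_lt lam z₀ C (by omega)]
  refine component_preimage_eq hlam (isOpen_cSet hC.isOpen (by omega))
    (isPreconnected_cSet hC.isConnected.isPreconnected (by omega)) (zero_mem_cSet_one hD hC) ?_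
  rw [expMap_cyclePt]
  exact h.cyclePt_mem_cSet hC.cyclePt_mem (by omega)

/-- The sets `H_s` are the images of the complement of `C_1` under the branches of the inverse. -/
lemma IsAttractingCycle.exists_hSet_eq (h : IsAttractingCycle lam p z₀)
    (hlam : lam ≠ 0) (hp : 2 ≤ p) (hD : IsInitialDomain lam p z₀ D)
    (hC : IsTruncatedDomain lam p z₀ D C) {w : ℂ} (hw : w ∉ cSet lam p z₀ C 0) :
    ∃ G : ℂ → ℂ, ContinuousOn G (cSet lam p z₀ C 1)ᶜ ∧
      (∀ x ∈ (cSet lam p z₀ C 1)ᶜ, expMap lam (G x) = x) ∧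
      (∃ A : ℝ, ∀ x ∈ (cSet lam p z₀ C 1)ᶜ, |(G x).im| ≤ A) ∧
      ∀ s : ℤ, hSet lam p z₀ C w s
        = (fun x => G x + s * (2 * Real.pi * Complex.I)) '' (cSet lam p z₀ C 1)ᶜ := by
  obtain ⟨L, hL, hLf, B, hB⟩ := h.exists_branch hlam hp hD hC
  have hw1 : expMap lam w ∈ (cSet lam p z₀ C 1)ᶜ := by
    rw [h.cSet_zero hlam hp hD hC] at hw; exact hw
  have heq := component_eq_image_branch hlam hL hLf subset_rfl
    (h.isPreconnected_compl_cSet hlam hp hD hC) hw1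
  set c := w - L (expMap lam w) with hc
  refine ⟨fun x => L x + c, hL.add continuousOn_const, fun x hx => ?_, ⟨B + |c.im|, fun x hx => ?_⟩,
    fun s => ?_⟩
  · obtain ⟨n, hn⟩ := (expMap_eq_iff hlam).1 (hLf _ hw1).symm
    have : c = n * (2 * Real.pi * Complex.I) := sub_eq_iff_eq_add'.2 hn
    rw [this, expMap_add_int, hLf x hx]
  · rw [Complex.add_im]
    exact (abs_add_le _ _).trans (add_le_add (hB x hx) le_rfl)
  · rw [hSet, h.cSet_zero hlam hp hD hC, ← preimage_compl, heq, image_image]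
    refine image_congr fun x _ => ?_
    ring

/-- The properties of the sets `H_s` on which the construction is based. -/
structure IsTractFamily (lam : ℂ) (p : ℕ) (k : ℕ → ℤ) (H : ℤ → Set ℂ) (A : ℝ) : Prop where
  isClosed : ∀ s, IsClosed (H s)
  im_le : ∀ s, ∀ z ∈ H s, |z.im - 2 * Real.pi * s| ≤ A
  exists_re : ∃ ρ : ℝ, ∀ s, ∃ z ∈ H s, z.re = ρ
  exists_pullback : ∃ t₀ : ℤ, ∀ t, t₀ ≤ t → ∀ x ∈ H t, ∀ s, ∃ y ∈ H s,
    (expMap lam)^[p] y = x ∧ ∀ j, 1 ≤ j → j < p → (expMap lam)^[j] y ∈ H (k j)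

theorem IsAttractingCycle.isTractFamily (h : IsAttractingCycle lam p z₀)
    (hlam : lam ≠ 0) (hp : 2 ≤ p) (hD : IsInitialDomain lam p z₀ D)
    (hC : IsTruncatedDomain lam p z₀ D C) {w : ℂ} (hw : w ∉ cSet lam p z₀ C 0) {k : ℕ → ℤ}
    (hk : ∀ j : ℕ, 1 ≤ j → j < p → basinComp lam p z₀ j ⊆ hSet lam p z₀ C w (k j)) :
    ∃ A, IsTractFamily lam p k (hSet lam p z₀ C w) A := by
  obtain ⟨G, hG, hGf, ⟨A, hA⟩, hH⟩ := h.exists_hSet_eq hlam hp hD hC hw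
  have him : ∀ s, ∀ z ∈ hSet lam p z₀ C w s, |z.im - 2 * Real.pi * s| ≤ A := by
    intro s z hz
    rw [hH] at hz
    obtain ⟨x, hx, rfl⟩ := hz
    convert hA x hx using 2
    simp
    ring
  have hinv : ∀ s : ℤ, ∀ x ∉ cSet lam p z₀ C 1, ∃ y ∈ hSet lam p z₀ C w s, expMap lam y = x := by
    intro s x hx
    refine ⟨G x + s * (2 * Real.pi * Complex.I), by rw [hH]; exact ⟨x, hx, rfl⟩, ?_⟩
    rw [expMap_add_int, hGf x hx]
  refine ⟨A, ⟨fun s => ?_, him, ?_, ?_⟩⟩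
  · have hcl : IsClosed (cSet lam p z₀ C 1)ᶜ :=
      (isOpen_cSet hC.isOpen (by omega)).isClosed_compl
    rw [hH]
    have := closure_image_branch (W := (cSet lam p z₀ C 1)ᶜ) (lam := lam)
      (G := fun x => G x + s * (2 * Real.pi * Complex.I)) (hG.add continuousOn_const)
      (fun x hx => by rw [expMap_add_int, hGf x hx]) hcl.closure_eq.subset
    rw [hcl.closure_eq] at this
    exact closure_eq_iff_isClosed.1 this
  · have hw1 : expMap lam w ∉ cSet lam p z₀ C 1 := by
      rw [h.cSet_zero hlam hp hD hC] at hw; exact hw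
    refine ⟨(G (expMap lam w)).re, fun s => ⟨G (expMap lam w) + s * (2 * Real.pi * Complex.I),
      by rw [hH]; exact ⟨_, hw1, rfl⟩, ?_⟩⟩
    simp
  -- If `H_t` meets `H_{k_j}` then `2π |t - k_j| ≤ 2A`; beyond `t₀` this is impossible for every `j
  -- < p`.
  · obtain ⟨t₀, ht₀⟩ := exists_int_gt (A / Real.pi + ∑ j ∈ Finset.range p, |(k j : ℝ)|)
    refine ⟨t₀, fun t ht x hx s => ?_⟩
    -- For `j < p`, `C_j ⊆ U_j ⊆ H_{k_j}`, which is too far from `H_t`. For `j = p`, `f` maps `C_p`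
    -- into `C_1`, while it maps `H_t` into the complement of `C_1`.
    have hxC : ∀ j, 1 ≤ j → j ≤ p → x ∉ cSet lam p z₀ C j := by
      intro j hj1 hj hxj
      rcases hj.eq_or_lt with rfl | hlt
      · rw [cSet_self] at hxj
        rw [hH] at hx
        obtain ⟨x', hx', rfl⟩ := hx
        have h1 := hC.closure_subset (subset_closure (hC.subset hxj))
        rw [expMap_add_int, hGf _ hx'] at h1
        exact hx' h1
      · have h1 := him _ _ (hk j hj1 hlt (h.cSet_subset_basinComp hp hD hC hlt hxj))
        have h2 := him _ _ hx
        have h3 : |(k j : ℝ)| ≤ ∑ j ∈ Finset.range p, |(k j : ℝ)| :=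
          Finset.single_le_sum (f := fun j => |(k j : ℝ)|) (fun _ _ => abs_nonneg _)
            (Finset.mem_range.2 hlt)
        have h4 : (t₀ : ℝ) ≤ t := by exact_mod_cast ht
        have h5 : A / Real.pi < t - k j := by
          linarith [le_abs_self (k j : ℝ)]
        rw [div_lt_iff₀ Real.pi_pos] at h5
        have := (abs_le.1 h1).2
        have := (abs_le.1 h2).1
        linarith
    -- Since `f` maps `C_j` into `C_{j+1}`, each pull-back shortens the list of avoided sets by one.
    -- `C_1` is still avoided after `p - 1` pull-backs, which leaves one more for the free index
    -- `s`.
    have key : ∀ i, i + 1 ≤ p → ∃ y, (expMap lam)^[i] y = x ∧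
        (∀ j, 1 ≤ j → j ≤ p - i → y ∉ cSet lam p z₀ C j) ∧
        ∀ m < i, (expMap lam)^[m] y ∈ hSet lam p z₀ C w (k (p - i + m)) := by
      intro i
      induction i with
      | zero => exact fun _ => ⟨x, rfl, fun j h1 h2 => hxC j h1 h2, fun m hm => absurd hm (by omega)⟩
      | succ i ih =>
        intro hi
        obtain ⟨y, hy, hyC, hyH⟩ := ih (by omega)
        obtain ⟨y', hy', rfl⟩ := hinv (k (p - (i + 1))) y (hyC 1 le_rfl (by omega))
        refine ⟨y', hy, fun j hj1 hj hc => ?_, fun m hm => ?_⟩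
        · exact hyC (j + 1) (by omega) (by omega) (cSet_subset_preimage (by omega) hc)
        · cases m with
          | zero => exact hy'
          | succ m =>
            rw [show p - (i + 1) + (m + 1) = p - i + m by omega]
            exact hyH m (by omega)
    obtain ⟨y, hy, hyC, hyH⟩ := key (p - 1) (by omega)
    obtain ⟨y', hy', rfl⟩ := hinv s y (hyC 1 le_rfl (by omega))
    refine ⟨y', hy', ?_, fun j hj1 hj => ?_⟩
    · rw [← hy, ← Function.iterate_succ_apply, show (p - 1).succ = p by omega]
    · have := hyH (j - 1) (by omega)
      rw [← Function.iterate_succ_apply, show (j - 1).succ = j by omega,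
        show p - (p - 1) + (j - 1) = j by omega] at this
      exact this


/-! ### Bounded expanding orbits lie in the Julia set -/

lemma deriv_iterate_expMap_succ (lam z : ℂ) (n : ℕ) :
    deriv (expMap lam)^[n + 1] z = (expMap lam)^[n + 1] z * deriv (expMap lam)^[n] z := by
  rw [Function.iterate_succ', deriv_comp z (differentiable_expMap lam).differentiableAt
    ((differentiable_expMap lam).iterate n).differentiableAt, deriv_expMap]
  rfl

/-- The derivatives of the iterates at `z` grow at least like `2 ^ n`, which excludes a finite
locally uniform limit; boundedness of the orbit excludes the limit infinity. -/
lemma mem_juliaSet_of_isBounded {lam z : ℂ}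
    (hb : Bornology.IsBounded (range fun n : ℕ => (expMap lam)^[n] z))
    (h2 : ∀ n, 1 ≤ n → 2 ≤ ‖(expMap lam)^[n] z‖) : z ∈ juliaSet (expMap lam) := by
  rintro ⟨r, hr, hN⟩
  have hd : ∀ n : ℕ, (2 : ℝ) ^ n ≤ ‖deriv (expMap lam)^[n] z‖ := by
    intro n
    induction n with
    | zero => simp
    | succ n ih =>
      rw [deriv_iterate_expMap_succ, norm_mul, pow_succ']
      exact mul_le_mul (h2 _ (by omega)) ih (by positivity) (norm_nonneg _)
  obtain ⟨ψ, hψ, ⟨h, hh⟩ | hinf⟩ := hN id strictMono_id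
  · have h1 := hh.deriv (Eventually.of_forall fun n =>
      ((differentiable_expMap lam).iterate _).differentiableOn) Metric.isOpen_ball
    have h3 := (h1.tendsto_at (Metric.mem_ball_self hr)).norm
    have h4 : Tendsto (fun n => ‖deriv (expMap lam)^[ψ n] z‖) atTop atTop :=
      tendsto_atTop_mono (fun n => hd (ψ n))
        ((tendsto_pow_atTop_atTop_of_one_lt one_lt_two).comp hψ.tendsto_atTop)
    exact not_tendsto_nhds_of_tendsto_atTop h4 _ h3
  · obtain ⟨M, hM⟩ := isBounded_iff_forall_norm_le.1 hb
    obtain ⟨n, hn⟩ := (hinf {z} (by simpa using hr) isCompact_singleton (M + 1)).exists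
    have h5 := hn z rfl
    have h6 := hM _ ⟨ψ n, rfl⟩
    simp only [id] at h5
    linarith

/-! ### Hausdorff dimension of sets coded by sequences -/

/-- Cut `[0, 1)` at the partial sums of the weights; `y` belongs to the interval where the partial
sums first exceed it. -/
lemma exists_digits {T : Finset ℕ} {q : ℕ → ℝ} (hs : ∑ t ∈ T, q t = 1) :
    ∃ a : ℕ → ℝ, ∀ y ∈ Ico (0 : ℝ) 1, ∃ t ∈ T, ∃ x ∈ Ico (0 : ℝ) 1, y = a t + q t * x := by
  set q' : ℕ → ℝ := fun i => if i ∈ T then q i else 0 with hq'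
  refine ⟨fun m => ∑ i ∈ Finset.range m, q' i, fun y hy => ?_⟩
  obtain ⟨n, hn⟩ := T.exists_nat_subset_range
  have h1 : ∑ i ∈ Finset.range n, q' i = 1 := by
    rw [← hs, hq', ← Finset.sum_filter]
    congr 1
    ext i
    simp only [Finset.mem_filter]
    exact ⟨fun h => h.2, fun h => ⟨hn h, h⟩⟩
  have hex : ∃ m, y < ∑ i ∈ Finset.range m, q' i := ⟨n, by rw [h1]; exact hy.2⟩
  classical
  have hm := Nat.find_spec hex
  have hmin := fun k hk => Nat.find_min (m := k) hex hk
  obtain ⟨m, hm0⟩ : ∃ m, Nat.find hex = m + 1 := by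
    refine Nat.exists_eq_succ_of_ne_zero fun h0 => ?_
    rw [h0] at hm
    simp only [Finset.range_zero, Finset.sum_empty] at hm
    exact absurd hy.1 (not_le.2 hm)
  rw [hm0] at hm
  have hle := not_lt.1 (hmin m (by omega))
  rw [Finset.sum_range_succ] at hm
  have hpos : 0 < q' m := by linarith
  have hmT : m ∈ T := by
    by_contra h
    simp [hq', h] at hpos
  have hqm : q' m = q m := by simp [hq', hmT]
  rw [hqm] at hm hpos
  refine ⟨m, hmT, (y - ∑ i ∈ Finset.range m, q' i) / q m, ⟨?_, ?_⟩, ?_⟩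
  · exact div_nonneg (by linarith) hpos.le
  · rw [div_lt_one hpos]; linarith
  · field_simp; ring

/-- The digits are read off by iterating the map `S` that rescales each interval of the partition to
`[0, 1)`. Agreement of `n` digits puts two points in a common interval of length the product of
their weights. -/
lemma exists_coding {T : Finset ℕ} {q : ℕ → ℝ} (hq : ∀ t ∈ T, 0 < q t) (hs : ∑ t ∈ T, q t = 1) :
    ∃ ω : ℝ → ℕ → ℕ, (∀ y ∈ Ico (0 : ℝ) 1, ∀ n, ω y n ∈ T) ∧
      ∀ y ∈ Ico (0 : ℝ) 1, ∀ y' ∈ Ico (0 : ℝ) 1, ∀ n, (∀ i < n, ω y i = ω y' i) →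
        |y - y'| ≤ ∏ i ∈ Finset.range n, q (ω y i) := by
  obtain ⟨a, ha⟩ := exists_digits hs
  choose! d hd S hS hy using ha
  have hmaps : ∀ n, ∀ y ∈ Ico (0 : ℝ) 1, S^[n] y ∈ Ico (0 : ℝ) 1 := by
    intro n
    induction n with
    | zero => exact fun y hy => hy
    | succ n ih =>
      intro y hy
      rw [Function.iterate_succ_apply]
      exact ih _ (hS y hy)
  refine ⟨fun y n => d (S^[n] y), fun y hy n => hd _ (hmaps n y hy), ?_⟩
  intro y h y' h' n
  induction n generalizing y y' with
  | zero =>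
    intro _
    simp only [Finset.range_zero, Finset.prod_empty]
    rw [abs_le]
    constructor <;> linarith [h.1, h.2, h'.1, h'.2]
  | succ n ih =>
    intro heq
    have h0 : d y = d y' := heq 0 (by omega)
    have h1 := ih _ (hS y h) _ (hS y' h') fun i hi => heq (i + 1) (by omega)
    have h2 : y - y' = q (d y) * (S y - S y') := by
      have e1 := hy y h
      have e2 := hy y' h'
      rw [← h0] at e2
      linear_combination e1 - e2
    rw [h2, abs_mul, abs_of_pos (hq _ (hd y h)), Finset.prod_range_succ', mul_comm]
    exact mul_le_mul_of_nonneg_right h1 (hq _ (hd y h)).le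

lemma exists_exponent {T : Finset ℕ} {c : ℕ → ℝ} (hc : ∀ t ∈ T, 0 < c t)
    (hs : 1 < ∑ t ∈ T, c t) : ∃ d : ℝ, 1 < d ∧ 1 ≤ ∑ t ∈ T, c t ^ d := by
  have h1 : Tendsto (fun d : ℝ => ∑ t ∈ T, c t ^ d) (𝓝 1) (𝓝 (∑ t ∈ T, c t ^ (1 : ℝ))) :=
    tendsto_finsetSum _ fun t ht =>
      (Real.continuous_const_rpow (hc t ht).ne').tendsto 1
  simp only [Real.rpow_one] at h1
  have h2 : ∀ᶠ d in 𝓝[>] (1 : ℝ), 1 < ∑ t ∈ T, c t ^ d :=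
    (h1.eventually (lt_mem_nhds hs)).filter_mono nhdsWithin_le_nhds
  obtain ⟨d, hd1, hd2⟩ := (h2.and self_mem_nhdsWithin).exists
  exact ⟨d, hd2, hd1.le⟩

/-- A set contains a coded subset of dimension greater than `1` if the distances of its points are
bounded below by products of weights whose sum is greater than `1`. -/
lemma one_lt_dimH_of_coding {T : Finset ℕ} {c : ℕ → ℝ} (hc : ∀ t ∈ T, 0 < c t)
    (hc1 : ∀ t ∈ T, c t ≤ 1 / 2) (hs : 1 < ∑ t ∈ T, c t) {E : Set ℂ} {Z : (ℕ → ℕ) → ℂ} {K : ℝ}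
    (hK : 0 ≤ K) (hZ : ∀ ω : ℕ → ℕ, (∀ n, ω n ∈ T) → Z ω ∈ E)
    (hd : ∀ ω ω' : ℕ → ℕ, (∀ n, ω n ∈ T) → (∀ n, ω' n ∈ T) → ∀ n, (∀ i < n, ω i = ω' i) →
      ω n ≠ ω' n → ∏ i ∈ Finset.range n, c (ω i) ≤ K * ‖Z ω - Z ω'‖) :
    1 < dimH E := by
  obtain ⟨d, hd1, hsum⟩ := exists_exponent hc hs
  set S := ∑ t ∈ T, c t ^ d with hS
  have hS0 : 0 < S := by linarith
  set q : ℕ → ℝ := fun t => c t ^ d / S with hq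
  have hqc : ∀ t ∈ T, q t ≤ c t ^ d := fun t ht =>
    div_le_self (Real.rpow_nonneg (hc t ht).le d) hsum
  have hq0 : ∀ t ∈ T, 0 < q t := fun t ht => div_pos (Real.rpow_pos_of_pos (hc t ht) d) hS0
  obtain ⟨ω, hωT, hω⟩ := exists_coding (T := T) (q := q) hq0
    (by rw [hq, ← Finset.sum_div, ← hS, div_self hS0.ne'])
  -- The weights are `c ^ d` divided by their sum `S ≥ 1`, so the length of a coding interval is at
  -- most the `d`-th power of the product of the `c`, which `hd` compares with the distance in the
  -- plane.
  have key : ∀ y ∈ Ico (0 : ℝ) 1, ∀ y' ∈ Ico (0 : ℝ) 1,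
      |y - y'| ≤ (K * ‖Z (ω y) - Z (ω y')‖) ^ d := by
    intro y hy y' hy'
    by_cases hall : ω y = ω y'
    · have h0 : ∀ n : ℕ, |y - y'| ≤ (1 / 2) ^ n := by
        intro n
        refine (hω y hy y' hy' n fun i _ => by rw [hall]).trans ?_
        calc ∏ i ∈ Finset.range n, q (ω y i) ≤ ∏ _i ∈ Finset.range n, (1 / 2 : ℝ) := by
              refine Finset.prod_le_prod (fun i _ => (hq0 _ (hωT y hy i)).le) fun i _ => ?_
              have hT := hωT y hy i
              refine (hqc _ hT).trans (le_trans ?_ (hc1 _ hT))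
              exact Real.rpow_le_self_of_le_one (hc _ hT).le (by linarith [hc1 _ hT]) hd1.le
          _ = (1 / 2) ^ n := by simp
      have h1 : |y - y'| ≤ 0 := ge_of_tendsto'
        (tendsto_pow_atTop_nhds_zero_of_lt_one (by norm_num) (by norm_num)) h0
      exact h1.trans (Real.rpow_nonneg (mul_nonneg hK (norm_nonneg _)) d)
    · have hex : ∃ n, ω y n ≠ ω y' n := Function.ne_iff.1 hall
      classical
      have hn := Nat.find_spec hex
      have hmin : ∀ i < Nat.find hex, ω y i = ω y' i := fun i hi =>
        not_not.1 (Nat.find_min hex hi)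
      refine (hω y hy y' hy' _ hmin).trans ?_
      calc ∏ i ∈ Finset.range (Nat.find hex), q (ω y i)
          ≤ ∏ i ∈ Finset.range (Nat.find hex), c (ω y i) ^ d :=
            Finset.prod_le_prod (fun i _ => (hq0 _ (hωT y hy i)).le)
              fun i _ => hqc _ (hωT y hy i)
        _ = (∏ i ∈ Finset.range (Nat.find hex), c (ω y i)) ^ d :=
            Real.finsetProd_rpow _ _ (fun i _ => (hc _ (hωT y hy i)).le) d
        _ ≤ _ := Real.rpow_le_rpow (Finset.prod_nonneg fun i _ => (hc _ (hωT y hy i)).le)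
            (hd _ _ (hωT y hy) (hωT y' hy') _ hmin hn) (by linarith)
  have hinj : InjOn (fun y => Z (ω y)) (Ico 0 1) := by
    intro y hy y' hy' h
    have h1 := key y hy y' hy'
    simp only at h
    rw [h, sub_self, norm_zero, mul_zero, Real.zero_rpow (by linarith)] at h1
    exact sub_eq_zero.1 (abs_nonpos_iff.1 h1)
  set g := Function.invFunOn (fun y => Z (ω y)) (Ico (0 : ℝ) 1)
  have hg : ∀ y ∈ Ico (0 : ℝ) 1, g (Z (ω y)) = y := fun y hy => hinj.leftInvOn_invFunOn hy
  set E' := (fun y => Z (ω y)) '' Ico (0 : ℝ) 1 with hE'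
  have hd0 : 0 ≤ d := by linarith
  have hhol : HolderOnWith (K ^ d).toNNReal d.toNNReal g E' := by
    rintro _ ⟨y, hy, rfl⟩ _ ⟨y', hy', rfl⟩
    rw [hg y hy, hg y' hy', edist_dist, edist_dist, Real.dist_eq, dist_eq_norm,
      Real.coe_toNNReal d hd0, ENNReal.ofReal_rpow_of_nonneg (norm_nonneg _) hd0]
    change _ ≤ ENNReal.ofReal (K ^ d) * _
    rw [← ENNReal.ofReal_mul (Real.rpow_nonneg hK d), ← Real.mul_rpow hK (norm_nonneg _)]
    exact ENNReal.ofReal_le_ofReal (key y hy y' hy')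
  have hgE : g '' E' = Ico 0 1 := by
    rw [hE', image_image]
    exact (image_congr hg).trans (image_id' _)
  have h1 := hhol.dimH_image_le (Real.toNNReal_pos.2 (by linarith))
  have h2 : dimH (Ico (0 : ℝ) 1) = 1 := by
    have := Real.dimH_of_mem_nhds (Ico_mem_nhds (show (0 : ℝ) < 1 / 2 by norm_num)
      (show (1 / 2 : ℝ) < 1 by norm_num))
    simpa using this
  rw [hgE, h2] at h1
  have hE : E' ⊆ E := by
    rintro _ ⟨y, hy, rfl⟩
    exact hZ _ (hωT y hy)
  have h3 : (d.toNNReal : ENNReal) ≤ dimH E' := by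
    by_contra! hlt
    refine absurd h1 (not_le.2 ?_)
    refine ENNReal.div_lt_of_lt_mul ?_
    rwa [one_mul]
  refine lt_of_lt_of_le ?_ (h3.trans (dimH_mono hE))
  rw [← ENNReal.coe_one, ENNReal.coe_lt_coe, Real.lt_toNNReal_iff_coe_lt]
  simpa using hd1

/-! ### Iterated logarithms -/

/-- The logarithm with an additive constant. -/
def shiftLog (c u : ℝ) : ℝ := Real.log u + c

lemma shiftLog_le_shiftLog {c c' u v : ℝ} (hc : c ≤ c') (hu : 0 < u) (huv : u ≤ v) :
    shiftLog c u ≤ shiftLog c' v :=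
  add_le_add (Real.log_le_log hu huv) hc

lemma tendsto_shiftLog_iterate (c : ℝ) (n : ℕ) : Tendsto (shiftLog c)^[n] atTop atTop := by
  have h : Tendsto (shiftLog c) atTop atTop :=
    tendsto_atTop_add_const_right _ _ Real.tendsto_log_atTop
  exact h.iterate n

lemma isLittleO_shiftLog_iterate (c : ℝ) {n : ℕ} (hn : 1 ≤ n) :
    (shiftLog c)^[n] =o[atTop] (id : ℝ → ℝ) := by
  have h1 : shiftLog c =o[atTop] (id : ℝ → ℝ) :=
    Real.isLittleO_log_id_atTop.add (Asymptotics.isLittleO_const_id_atTop c)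
  induction n, hn using Nat.le_induction with
  | base => exact h1
  | succ n hn ih => exact (ih.comp_tendsto (tendsto_shiftLog_iterate c 1)).trans h1

/-- A mean value estimate: the derivative of the `n`-th iterate is the reciprocal of the product of
the earlier iterates, and it is largest at the left end `u`. One step is `log x ≤ x - 1` with `x = b
/ a`. -/
lemma shiftLog_iterate_sub_le {c u v : ℝ} (huv : u ≤ v) (n : ℕ)
    (hu : ∀ i < n, 0 < (shiftLog c)^[i] u) :
    (shiftLog c)^[n] u ≤ (shiftLog c)^[n] v ∧
      ((shiftLog c)^[n] v - (shiftLog c)^[n] u) * ∏ i ∈ Finset.range n, (shiftLog c)^[i] u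
        ≤ v - u := by
  induction n with
  | zero => simpa using huv
  | succ n ih =>
    obtain ⟨h1, h2⟩ := ih fun i hi => hu i (by omega)
    have hp := hu n (by omega)
    rw [Function.iterate_succ_apply', Function.iterate_succ_apply', Finset.prod_range_succ]
    refine ⟨shiftLog_le_shiftLog le_rfl hp h1, ?_⟩
    set a := (shiftLog c)^[n] u
    set b := (shiftLog c)^[n] v
    have h3 : shiftLog c b - shiftLog c a ≤ (b - a) / a := by
      unfold shiftLog
      rw [add_sub_add_right_eq_sub, ← Real.log_div (by linarith) hp.ne', sub_div, div_self hp.ne']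
      exact Real.log_le_sub_one_of_pos (div_pos (by linarith) hp)
    have hprod : 0 ≤ ∏ i ∈ Finset.range n, (shiftLog c)^[i] u :=
      Finset.prod_nonneg fun i hi => (hu i (by have := Finset.mem_range.1 hi; omega)).le
    rw [le_div_iff₀ hp] at h3
    calc (shiftLog c b - shiftLog c a) * ((∏ i ∈ Finset.range n, (shiftLog c)^[i] u) * a)
        = ((shiftLog c b - shiftLog c a) * a) * ∏ i ∈ Finset.range n, (shiftLog c)^[i] u := by ring
      _ ≤ (b - a) * ∏ i ∈ Finset.range n, (shiftLog c)^[i] u :=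
          mul_le_mul_of_nonneg_right h3 hprod
      _ ≤ v - u := h2

/-! ### Estimates along orbits -/

/-- The set where `‖f‖ ≤ R` is a left half-plane, hence convex, and there `‖f'‖ = ‖f‖ ≤ R`. Global
expansion bounds follow without any distortion theorem. -/
lemma norm_expMap_sub_le {lam a b : ℂ} {R : ℝ} (ha : ‖expMap lam a‖ ≤ R)
    (hb : ‖expMap lam b‖ ≤ R) : ‖expMap lam a - expMap lam b‖ ≤ R * ‖a - b‖ := by
  have hconv : Convex ℝ {z : ℂ | z.re ≤ max a.re b.re} := convex_halfSpace_re_le _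
  refine hconv.norm_image_sub_le_of_norm_deriv_le (𝕜 := ℂ) (f := expMap lam)
    (fun x _ => (differentiable_expMap lam).differentiableAt) (fun x hx => ?_)
    (by simp) (by simp)
  have hx' : x.re ≤ max a.re b.re := hx
  rw [deriv_expMap]
  rw [norm_expMap] at ha hb ⊢
  rcases le_max_iff.1 hx' with h | h
  · exact (mul_le_mul_of_nonneg_left (Real.exp_le_exp.2 h) (norm_nonneg _)).trans ha
  · exact (mul_le_mul_of_nonneg_left (Real.exp_le_exp.2 h) (norm_nonneg _)).trans hb

lemma norm_iterate_sub_le {lam : ℂ} {b : ℕ → ℝ} (n : ℕ) (y y' : ℂ)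
    (h : ∀ i < n, ‖(expMap lam)^[n - i] y‖ ≤ b i) (h' : ∀ i < n, ‖(expMap lam)^[n - i] y'‖ ≤ b i) :
    ‖(expMap lam)^[n] y - (expMap lam)^[n] y'‖ ≤ (∏ i ∈ Finset.range n, b i) * ‖y - y'‖ := by
  induction n generalizing y y' with
  | zero => simp
  | succ n ih =>
    have h1 := ih (expMap lam y) (expMap lam y')
      (fun i hi => by
        rw [← Function.iterate_succ_apply, show (n - i).succ = n + 1 - i by omega]
        exact h i (by omega))
      (fun i hi => by
        rw [← Function.iterate_succ_apply, show (n - i).succ = n + 1 - i by omega]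
        exact h' i (by omega))
    have h2 := h n (by omega)
    have h3 := h' n (by omega)
    rw [Nat.add_sub_cancel_left, Function.iterate_one] at h2 h3
    rw [Function.iterate_succ_apply, Function.iterate_succ_apply, Finset.prod_range_succ, mul_assoc]
    refine h1.trans (mul_le_mul_of_nonneg_left (norm_expMap_sub_le h2 h3) ?_)
    refine Finset.prod_nonneg fun i hi => (norm_nonneg _).trans (h i ?_)
    have := Finset.mem_range.1 hi
    omega


/-! ### Points coded by sequences of tracts -/

variable {k : ℕ → ℤ} {H : ℤ → Set ℂ} {A : ℝ}

/-- A constant controlling the inverse branches with values in `H_{k_1}, …, H_{k_{p-1}}`. -/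
def branchBound (lam : ℂ) (p : ℕ) (k : ℕ → ℤ) (A : ℝ) : ℝ :=
  |Real.log ‖lam‖| + (|A| + 2 * Real.pi * ∑ j ∈ Finset.range p, |(k j : ℝ)|)

lemma abs_log_le_branchBound (lam : ℂ) (p : ℕ) (k : ℕ → ℤ) (A : ℝ) :
    |Real.log ‖lam‖| ≤ branchBound lam p k A := by
  unfold branchBound
  have : 0 ≤ 2 * Real.pi * ∑ j ∈ Finset.range p, |(k j : ℝ)| :=
    mul_nonneg Real.two_pi_pos.le (Finset.sum_nonneg fun _ _ => abs_nonneg _)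
  linarith [abs_nonneg A]

lemma abs_re_le_shiftLog (hlam : lam ≠ 0) {y : ℂ} (h1 : 1 ≤ ‖expMap lam y‖) :
    |y.re| ≤ shiftLog |Real.log ‖lam‖| ‖expMap lam y‖ := by
  rw [re_eq_log hlam, shiftLog]
  refine (abs_sub _ _).trans ?_
  rw [abs_of_nonneg (Real.log_nonneg h1)]

lemma IsTractFamily.abs_im_le (h : IsTractFamily lam p k H A) {s : ℤ} {y : ℂ} (hy : y ∈ H s) :
    |y.im| ≤ A + 2 * Real.pi * |(s : ℝ)| := by
  have h1 := h.im_le s y hy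
  have h2 : |y.im| ≤ |y.im - 2 * Real.pi * s| + |2 * Real.pi * (s : ℝ)| := by
    simpa using abs_add_le (y.im - 2 * Real.pi * s) (2 * Real.pi * s)
  rw [abs_mul, abs_of_pos Real.two_pi_pos] at h2
  linarith

lemma IsTractFamily.norm_bounds (h : IsTractFamily lam p k H A) (hlam : lam ≠ 0) {j : ℕ}
    (hj : j < p) {y : ℂ} (hy : y ∈ H (k j)) (h1 : 1 ≤ ‖expMap lam y‖) :
    shiftLog (-branchBound lam p k A) ‖expMap lam y‖ ≤ ‖y‖ ∧
      ‖y‖ ≤ shiftLog (branchBound lam p k A) ‖expMap lam y‖ := by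
  constructor
  · refine le_trans ?_ (Complex.re_le_norm y)
    rw [re_eq_log hlam, shiftLog]
    linarith [le_abs_self (Real.log ‖lam‖), abs_log_le_branchBound lam p k A]
  · have h2 := abs_re_le_shiftLog hlam h1
    have h3 := h.abs_im_le hy
    have h4 : |(k j : ℝ)| ≤ ∑ j ∈ Finset.range p, |(k j : ℝ)| :=
      Finset.single_le_sum (f := fun j => |(k j : ℝ)|) (fun _ _ => abs_nonneg _)
        (Finset.mem_range.2 hj)
    have h5 := mul_le_mul_of_nonneg_left h4 Real.two_pi_pos.le
    have h6 := Complex.norm_le_abs_re_add_abs_im y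
    unfold shiftLog branchBound at *
    linarith [le_abs_self A]

/-- Bounds for the last `p` points of an orbit that passes through `H_{k_1}, …, H_{k_{p-1}}`. -/
lemma IsTractFamily.orbit_bounds (h : IsTractFamily lam p k H A) (hlam : lam ≠ 0) {y : ℂ} {a b : ℝ}
    (hy : ∀ j, 1 ≤ j → j < p → (expMap lam)^[j] y ∈ H (k j))
    (ha : ∀ i < p, 2 ≤ (shiftLog (-branchBound lam p k A))^[i] a)
    (hay : a ≤ ‖(expMap lam)^[p] y‖) (hyb : ‖(expMap lam)^[p] y‖ ≤ b) {i : ℕ} (hi : i < p) :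
    2 ≤ ‖(expMap lam)^[p - i] y‖ ∧
      ‖(expMap lam)^[p - i] y‖ ≤ (shiftLog (branchBound lam p k A))^[i] b := by
  suffices hs : (shiftLog (-branchBound lam p k A))^[i] a ≤ ‖(expMap lam)^[p - i] y‖ ∧
      ‖(expMap lam)^[p - i] y‖ ≤ (shiftLog (branchBound lam p k A))^[i] b from
    ⟨(ha i hi).trans hs.1, hs.2⟩
  induction i with
  | zero => exact ⟨hay, hyb⟩
  | succ i ih =>
    obtain ⟨h1, h2⟩ := ih (by omega)
    have h3 := ha i (by omega)
    have he : expMap lam ((expMap lam)^[p - (i + 1)] y) = (expMap lam)^[p - i] y := by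
      rw [← Function.iterate_succ_apply' (expMap lam), show (p - (i + 1)).succ = p - i by omega]
    have h4 := h.norm_bounds hlam (by omega) (hy (p - (i + 1)) (by omega) (by omega))
      (by rw [he]; linarith)
    rw [he] at h4
    rw [Function.iterate_succ_apply', Function.iterate_succ_apply']
    exact ⟨(shiftLog_le_shiftLog le_rfl (by linarith) h1).trans h4.1,
      h4.2.trans (shiftLog_le_shiftLog le_rfl (by linarith) h2)⟩

/-- The points whose orbit visits the sets `H_{q ω_0}, H_{k_1}, …, H_{k_{p-1}}, H_{q ω_1}, …`
with the first point in each block of size comparable to `ω_n`. -/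
def codedPts (lam : ℂ) (p : ℕ) (k : ℕ → ℤ) (H : ℤ → Set ℂ) (q : ℕ) (B : ℝ) (ω : ℕ → ℕ) : Set ℂ :=
  {z | ∀ n, ((expMap lam)^[n * p] z ∈ H (q * ω n : ℕ) ∧ ‖(expMap lam)^[n * p] z‖ ≤ B * ω n) ∧
    ∀ j, 1 ≤ j → j < p → (expMap lam)^[n * p + j] z ∈ H (k j)}

lemma iterate_mem_codedPts {q : ℕ} {B : ℝ} {ω : ℕ → ℕ} {z : ℂ} (hz : z ∈ codedPts lam p k H q B ω) :
    (expMap lam)^[p] z ∈ codedPts lam p k H q B fun n => ω (n + 1) := by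
  intro n
  have h1 := hz (n + 1)
  simp only [Nat.succ_mul] at h1
  rw [← Function.iterate_add_apply]
  refine ⟨h1.1, fun j hj1 hj => ?_⟩
  rw [← Function.iterate_add_apply, show n * p + j + p = n * p + p + j by omega]
  exact h1.2 j hj1 hj

/-- The parameters of the construction: `T` is the set of symbols. -/
structure IsAlphabet (lam : ℂ) (p : ℕ) (k : ℕ → ℤ) (H : ℤ → Set ℂ) (A : ℝ) (q : ℕ) (B : ℝ)
    (T : Finset ℕ) : Prop where
  -- The strips around `H_{qτ}` for different `τ` are at distance at least `1`.
  separated : 2 * A + 1 ≤ 2 * Real.pi * q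
  bound : 2 * Real.pi * q + 1 ≤ B
  -- Real parts after a pull-back are at most a `p`-fold logarithm. This must be absorbed by the
  -- imaginary part of every possible next symbol, so that the size bound `B * σ` reproduces itself.
  log_bound : ∀ τ ∈ T, ∀ σ ∈ T, A + (shiftLog (branchBound lam p k A))^[p] (B * τ) ≤ σ
  le_sub : ∀ τ ∈ T, (τ : ℝ) ≤ 2 * Real.pi * q * τ - A
  two_le : ∀ τ ∈ T, ∀ i ≤ p, 2 ≤ (shiftLog (-branchBound lam p k A))^[i] (τ : ℝ)
  pullback : ∀ τ ∈ T, ∀ x ∈ H (q * τ : ℕ), ∀ s, ∃ y ∈ H s,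
    (expMap lam)^[p] y = x ∧ ∀ j, 1 ≤ j → j < p → (expMap lam)^[j] y ∈ H (k j)
  base : ∃ x : ℕ → ℂ, ∀ τ ∈ T, x τ ∈ H (q * τ : ℕ) ∧ ‖x τ‖ ≤ B * τ
  large : ∀ τ ∈ T, ∀ j < p, k j < (q * τ : ℕ)

variable {q : ℕ} {B : ℝ} {T : Finset ℕ}

lemma IsAlphabet.le_norm (hT : IsAlphabet lam p k H A q B T) (h : IsTractFamily lam p k H A)
    {τ : ℕ} (hτ : τ ∈ T) {x : ℂ} (hx : x ∈ H (q * τ : ℕ)) : (τ : ℝ) ≤ ‖x‖ := by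
  have h1 := h.im_le _ x hx
  have h2 := (abs_le.1 h1).1
  have h3 := hT.le_sub τ hτ
  push_cast at h2
  linarith [Complex.im_le_norm x]

lemma IsAlphabet.codedPts_bounds (hT : IsAlphabet lam p k H A q B T)
    (h : IsTractFamily lam p k H A) (hlam : lam ≠ 0) {ω : ℕ → ℕ} (hω : ∀ n, ω n ∈ T) {z : ℂ}
    (hz : z ∈ codedPts lam p k H q B ω) {i : ℕ} (hi : i < p) :
    2 ≤ ‖(expMap lam)^[p - i] z‖ ∧
      ‖(expMap lam)^[p - i] z‖ ≤ (shiftLog (branchBound lam p k A))^[i] (B * ω 1) := by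
  have h0 := (hz 0).2
  have h1 := (hz 1).1
  rw [one_mul] at h1
  simp only [zero_mul, zero_add] at h0
  exact h.orbit_bounds hlam h0 (fun i hi => hT.two_le _ (hω 1) i hi.le)
    (hT.le_norm h (hω 1) h1.1) h1.2 hi

/-- The inductive step of the construction. The imaginary part of `y` is at most `A + 2πqσ`, its
real part at most the `p`-fold logarithm of `B * τ`, and `log_bound` bounds the sum by `(2πq + 1)σ`.
-/
lemma IsAlphabet.exists_step (hT : IsAlphabet lam p k H A q B T)
    (h : IsTractFamily lam p k H A) (hlam : lam ≠ 0) (hp : 1 ≤ p) {τ σ : ℕ} (hτ : τ ∈ T)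
    (hσ : σ ∈ T) {x : ℂ} (hx : x ∈ H (q * τ : ℕ)) (hxB : ‖x‖ ≤ B * τ) :
    ∃ y ∈ H (q * σ : ℕ), ‖y‖ ≤ B * σ ∧ (expMap lam)^[p] y = x ∧
      ∀ j, 1 ≤ j → j < p → (expMap lam)^[j] y ∈ H (k j) := by
  obtain ⟨y, hy, hyx, hyk⟩ := hT.pullback τ hτ x hx (q * σ : ℕ)
  refine ⟨y, hy, ?_, hyx, hyk⟩
  have h1 := h.orbit_bounds (i := p - 1) (a := τ) (b := B * τ) hlam hyk (fun i hi => hT.two_le _ hτ i hi.le)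
    (by rw [hyx]; exact hT.le_norm h hτ hx) (by rw [hyx]; exact hxB) (by omega)
  rw [show p - (p - 1) = 1 by omega, Function.iterate_one] at h1
  have h2 := abs_re_le_shiftLog hlam (y := y) (by linarith [h1.1])
  have h3 : shiftLog |Real.log ‖lam‖| ‖expMap lam y‖
      ≤ (shiftLog (branchBound lam p k A))^[p] (B * τ) := by
    have := shiftLog_le_shiftLog (abs_log_le_branchBound lam p k A)
      (by linarith [h1.1]) h1.2
    rwa [← Function.iterate_succ_apply' (shiftLog _), show (p - 1).succ = p by omega] at this
  have h4 := h.abs_im_le hy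
  have h5 := hT.log_bound τ hτ σ hσ
  have h6 := mul_le_mul_of_nonneg_right hT.bound (Nat.cast_nonneg (α := ℝ) σ)
  have h7 := Complex.norm_le_abs_re_add_abs_im y
  rw [Int.cast_natCast, Nat.abs_cast] at h4
  push_cast at h4
  linarith

/-- Finite symbol words are realised by pulling back a base point. The size bound on the first point
makes the resulting nested closed sets compact, so their intersection is nonempty. -/
lemma IsAlphabet.codedPts_nonempty (hT : IsAlphabet lam p k H A q B T)
    (h : IsTractFamily lam p k H A) (hlam : lam ≠ 0) (hp : 1 ≤ p) {ω : ℕ → ℕ}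
    (hω : ∀ n, ω n ∈ T) : (codedPts lam p k H q B ω).Nonempty := by
  let K : (ℕ → ℕ) → ℕ → Set ℂ := fun ω N =>
    {z | ∀ n, (n ≤ N → (expMap lam)^[n * p] z ∈ H (q * ω n : ℕ) ∧
      ‖(expMap lam)^[n * p] z‖ ≤ B * ω n) ∧
      (n < N → ∀ j, 1 ≤ j → j < p → (expMap lam)^[n * p + j] z ∈ H (k j))}
  have hne : ∀ N, ∀ ω : ℕ → ℕ, (∀ n, ω n ∈ T) → (K ω N).Nonempty := by
    intro N
    induction N with
    | zero =>
      intro ω hω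
      obtain ⟨x, hx⟩ := hT.base
      refine ⟨x (ω 0), fun n => ⟨fun hn => ?_, fun hn => absurd hn (by omega)⟩⟩
      obtain rfl : n = 0 := by omega
      simpa using hx _ (hω 0)
    | succ N ih =>
      intro ω hω
      obtain ⟨x, hx⟩ := ih (fun n => ω (n + 1)) fun n => hω _
      have hx0 := (hx 0).1 (by omega)
      rw [zero_mul] at hx0
      obtain ⟨y, hy, hyB, rfl, hyk⟩ := hT.exists_step h hlam hp (hω 1) (hω 0) hx0.1 hx0.2
      refine ⟨y, fun n => ?_⟩
      cases n with
      | zero =>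
        refine ⟨fun _ => by simpa using ⟨hy, hyB⟩, fun _ j hj1 hj => ?_⟩
        simpa using hyk j hj1 hj
      | succ n =>
        rw [Nat.succ_mul]
        refine ⟨fun hn => ?_, fun hn j hj1 hj => ?_⟩
        · have := (hx n).1 (by omega)
          rwa [← Function.iterate_add_apply] at this
        · have := (hx n).2 (by omega) j hj1 hj
          rwa [← Function.iterate_add_apply, show n * p + j + p = n * p + p + j by omega] at this
  have hclosed : ∀ N, IsClosed (K ω N) := by
    intro N
    simp only [K, ofPred_forall, ofPred_and]
    refine isClosed_iInter fun n => IsClosed.inter ?_ ?_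
    · refine isClosed_iInter fun _ => IsClosed.inter ?_ ?_
      · exact (h.isClosed _).preimage (continuous_iterate_expMap lam _)
      · exact isClosed_le (continuous_iterate_expMap lam _).norm continuous_const
    · refine isClosed_iInter fun _ => isClosed_iInter fun j => isClosed_iInter fun _ =>
        isClosed_iInter fun _ => (h.isClosed _).preimage (continuous_iterate_expMap lam _)
  have hcomp : IsCompact (K ω 0) := by
    refine (isCompact_closedBall (0 : ℂ) (B * ω 0)).of_isClosed_subset (hclosed 0) fun z hz => ?_
    simpa using ((hz 0).1 le_rfl).2
  obtain ⟨z, hz⟩ := IsCompact.nonempty_iInter_of_sequence_nonempty_isCompact_isClosed (K ω)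
    (fun N z hz n => ⟨fun hn => (hz n).1 (by omega), fun hn => (hz n).2 (by omega)⟩)
    (fun N => hne N ω hω) hcomp hclosed
  rw [mem_iInter] at hz
  exact ⟨z, fun n => ⟨(hz n n).1 le_rfl, (hz (n + 1) n).2 (by omega)⟩⟩

/-- The bound for the derivative of `f^p` along the inverse branches with symbol `τ`. -/
def stretch (lam : ℂ) (p : ℕ) (k : ℕ → ℤ) (A B : ℝ) (τ : ℕ) : ℝ :=
  ∏ i ∈ Finset.range p, (shiftLog (branchBound lam p k A))^[i] (B * τ)

lemma IsAlphabet.two_le_shiftLog (hT : IsAlphabet lam p k H A q B T) {τ : ℕ} (hτ : τ ∈ T) {i : ℕ}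
    (hi : i ≤ p) : 2 ≤ (shiftLog (branchBound lam p k A))^[i] (B * τ) := by
  refine (hT.two_le τ hτ i hi).trans ?_
  have hb : 0 ≤ branchBound lam p k A := (abs_nonneg _).trans (abs_log_le_branchBound lam p k A)
  induction i with
  | zero =>
    have h1 : 1 ≤ B := by
      have := hT.bound
      have : 0 ≤ 2 * Real.pi * q := mul_nonneg Real.two_pi_pos.le (Nat.cast_nonneg _)
      linarith
    exact le_mul_of_one_le_left (Nat.cast_nonneg τ) h1
  | succ i ih =>
    rw [Function.iterate_succ_apply', Function.iterate_succ_apply']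
    refine shiftLog_le_shiftLog (by linarith) ?_ (ih (by omega))
    linarith [hT.two_le τ hτ i (by omega)]

lemma IsAlphabet.two_le_stretch (hT : IsAlphabet lam p k H A q B T) (hp : 1 ≤ p) {τ : ℕ}
    (hτ : τ ∈ T) : 2 ≤ stretch lam p k A B τ := by
  unfold stretch
  calc (2 : ℝ) = 2 ^ 1 := (pow_one 2).symm
    _ ≤ 2 ^ p := pow_le_pow_right₀ one_le_two hp
    _ = ∏ i ∈ Finset.range p, (2 : ℝ) := by simp
    _ ≤ _ := Finset.prod_le_prod (fun _ _ => by norm_num) fun i hi =>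
      hT.two_le_shiftLog hτ (Finset.mem_range.1 hi).le

lemma IsAlphabet.stretch_mono (hT : IsAlphabet lam p k H A q B T) {τ σ : ℕ} (hτ : τ ∈ T)
    (h : τ ≤ σ) {i : ℕ} (hi : i ≤ p) :
    (shiftLog (branchBound lam p k A))^[i] (B * τ)
      ≤ (shiftLog (branchBound lam p k A))^[i] (B * σ) := by
  have hB : 0 ≤ B := by
    have := hT.bound
    have : 0 ≤ 2 * Real.pi * q := mul_nonneg Real.two_pi_pos.le (Nat.cast_nonneg _)
    linarith
  refine (shiftLog_iterate_sub_le (mul_le_mul_of_nonneg_left (Nat.cast_le.2 h) hB) i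
    fun m hm => ?_).1
  linarith [hT.two_le_shiftLog hτ (i := m) (by omega)]

lemma IsAlphabet.one_le_norm_sub (hT : IsAlphabet lam p k H A q B T)
    (h : IsTractFamily lam p k H A) {ω ω' : ℕ} (hne : ω ≠ ω')
    {z z' : ℂ} (hz : z ∈ H (q * ω : ℕ)) (hz' : z' ∈ H (q * ω' : ℕ)) : 1 ≤ ‖z - z'‖ := by
  wlog hlt : ω < ω' generalizing ω ω' z z'
  · rw [norm_sub_rev]; exact this hne.symm hz' hz (by omega)
  have h1 := (abs_le.1 (h.im_le _ z hz)).2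
  have h2 := (abs_le.1 (h.im_le _ z' hz')).1
  have h3 : (ω : ℝ) + 1 ≤ ω' := by exact_mod_cast hlt
  have h4 : 0 ≤ 2 * Real.pi * q := mul_nonneg Real.two_pi_pos.le (Nat.cast_nonneg _)
  have h5 := mul_le_mul_of_nonneg_left h3 h4
  have h6 := hT.separated
  have h7 := Complex.abs_im_le_norm (z - z')
  rw [Complex.sub_im] at h7
  push_cast at h1 h2
  linarith [neg_abs_le (z.im - z'.im)]

/-- Block `i` is expanded by at most the stretch of the symbol at its end, `ω (i + 1)`. In the last
block the two end symbols differ, so both are bounded by the largest symbol `M`; the images then lie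
in separated strips. -/
lemma IsAlphabet.one_le_mul_norm_sub (hT : IsAlphabet lam p k H A q B T)
    (h : IsTractFamily lam p k H A) (hlam : lam ≠ 0) {M : ℕ} (hM : ∀ τ ∈ T, τ ≤ M) (hMT : M ∈ T)
    (n : ℕ) (ω ω' : ℕ → ℕ) (hω : ∀ n, ω n ∈ T) (hω' : ∀ n, ω' n ∈ T)
    (heq : ∀ i < n + 1, ω i = ω' i) (hne : ω (n + 1) ≠ ω' (n + 1)) (z z' : ℂ)
    (hz : z ∈ codedPts lam p k H q B ω) (hz' : z' ∈ codedPts lam p k H q B ω') :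
    1 ≤ stretch lam p k A B M *
      (∏ i ∈ Finset.range n, stretch lam p k A B (ω (i + 1))) * ‖z - z'‖ := by
  have hpow : ∀ τ ∈ T, 0 ≤ stretch lam p k A B τ := fun τ hτ =>
    Finset.prod_nonneg fun i hi => zero_le_two.trans
      (hT.two_le_shiftLog hτ (Finset.mem_range.1 hi).le)
  induction n generalizing ω ω' z z' with
  | zero =>
    have h1 : 1 ≤ ‖(expMap lam)^[p] z - (expMap lam)^[p] z'‖ := by
      have hz1 := (hz 1).1.1
      have hz2 := (hz' 1).1.1
      rw [one_mul] at hz1 hz2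
      exact hT.one_le_norm_sub h hne hz1 hz2
    have h2 := norm_iterate_sub_le p z z'
      (fun i hi => ((hT.codedPts_bounds h hlam hω hz hi).2).trans
        (hT.stretch_mono (hω 1) (hM _ (hω 1)) hi.le))
      (fun i hi => ((hT.codedPts_bounds h hlam hω' hz' hi).2).trans
        (hT.stretch_mono (hω' 1) (hM _ (hω' 1)) hi.le))
    simpa [stretch] using h1.trans h2
  | succ n ih =>
    have h1 := ih (fun n => ω (n + 1)) (fun n => ω' (n + 1)) (fun n => hω _) (fun n => hω' _)
      (fun i hi => heq _ (by omega)) hne _ _ (iterate_mem_codedPts hz)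
      (iterate_mem_codedPts hz')
    have h2 := norm_iterate_sub_le p z z'
      (fun i hi => (hT.codedPts_bounds h hlam hω hz hi).2)
      (fun i hi => by
        have := (hT.codedPts_bounds h hlam hω' hz' hi).2
        rwa [← heq 1 (by omega)] at this)
    refine h1.trans ?_
    rw [Finset.prod_range_succ', ← mul_assoc, mul_assoc _ _ ‖z - z'‖]
    refine mul_le_mul_of_nonneg_left h2 (mul_nonneg (hpow M hMT) ?_)
    exact Finset.prod_nonneg fun i _ => hpow _ (hω _)

/-- The set of all points whose itinerary is in `Σ'` and whose orbit is bounded. -/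
def boundedItinerarySet (lam : ℂ) (p : ℕ) (k : ℕ → ℤ) (H : ℤ → Set ℂ) : Set ℂ :=
  {z : ℂ | z ∈ juliaSet (expMap lam) ∧ (∃ s ∈ sigmaPrime p k, IsItinerary lam H z s) ∧
    Bornology.IsBounded (range fun n : ℕ => (expMap lam)^[n] z)}

lemma IsAlphabet.codedPts_subset (hT : IsAlphabet lam p k H A q B T)
    (h : IsTractFamily lam p k H A) (hlam : lam ≠ 0) (hp : 1 ≤ p) {ω : ℕ → ℕ}
    (hω : ∀ n, ω n ∈ T) {M : ℕ} (hM : ∀ τ ∈ T, τ ≤ M) :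
    codedPts lam p k H q B ω ⊆ boundedItinerarySet lam p k H := by
  intro z hz
  have hshift : ∀ n, (expMap lam)^[n * p] z ∈ codedPts lam p k H q B fun m => ω (m + n) := by
    intro n
    induction n with
    | zero => simpa using hz
    | succ n ih =>
      have := iterate_mem_codedPts ih
      rw [← Function.iterate_add_apply, show p + n * p = (n + 1) * p by ring] at this
      simpa [add_assoc, add_comm 1] using this
  have hbd : ∀ m, 1 ≤ m → ∃ n i, i < p ∧ (expMap lam)^[m] z
      = (expMap lam)^[p - i] ((expMap lam)^[n * p] z) := by
    intro m hm
    -- Dividing `m - 1` rather than `m` counts the first point of a block as the last one of the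
    -- preceding block, matching the offsets `p - i` with `i < p`.
    refine ⟨(m - 1) / p, p - 1 - (m - 1) % p, by omega, ?_⟩
    have h1 := Nat.mod_lt (m - 1) (show 0 < p by omega)
    have h2 := Nat.div_add_mod' (m - 1) p
    rw [← Function.iterate_add_apply]
    congr 1
    omega
  have hnorm : ∀ m, 1 ≤ m → 2 ≤ ‖(expMap lam)^[m] z‖ ∧ ‖(expMap lam)^[m] z‖
      ≤ ∑ i ∈ Finset.range p, |(shiftLog (branchBound lam p k A))^[i] (B * M)| := by
    intro m hm
    obtain ⟨n, i, hi, he⟩ := hbd m hm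
    rw [he]
    obtain ⟨h1, h2⟩ := hT.codedPts_bounds h hlam (fun m => hω (m + n)) (hshift n) hi
    refine ⟨h1, (h2.trans (hT.stretch_mono (hω _) (hM _ (hω _)) hi.le)).trans
      ((le_abs_self _).trans ?_)⟩
    exact Finset.single_le_sum
      (f := fun i => |(shiftLog (branchBound lam p k A))^[i] (B * M)|)
      (fun _ _ => abs_nonneg _) (Finset.mem_range.2 hi)
  have hbounded : Bornology.IsBounded (range fun n : ℕ => (expMap lam)^[n] z) := by
    rw [isBounded_iff_forall_norm_le]
    refine ⟨max ‖z‖ (∑ i ∈ Finset.range p, |(shiftLog (branchBound lam p k A))^[i] (B * M)|), ?_⟩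
    rintro _ ⟨m, rfl⟩
    rcases Nat.eq_zero_or_pos m with rfl | hm
    · exact le_max_left _ _
    · exact (hnorm m hm).2.trans (le_max_right _ _)
  refine ⟨mem_juliaSet_of_isBounded hbounded fun n hn => (hnorm n hn).1, ?_, hbounded⟩
  refine ⟨fun m => if m % p = 0 then (q * ω (m / p) : ℕ) else k (m % p), ⟨?_, ?_⟩, ?_⟩
  · intro n j hj1 hj
    have h1 : (n * p + j) % p = j := by rw [Nat.mul_add_mod', Nat.mod_eq_of_lt hj]
    simp only [h1]
    rw [if_neg (by omega)]
  · refine Frequently.of_forall fun n j hj1 hj => ?_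
    have h1 : n * p % p = 0 := Nat.mul_mod_left n p
    simp only [h1, if_true]
    rw [Nat.mul_div_cancel _ (by omega)]
    exact (hT.large _ (hω n) j hj).ne'
  · intro m
    have h2 := Nat.div_add_mod' m p
    have h3 := Nat.mod_lt m (show 0 < p by omega)
    simp only
    split_ifs with h0
    · have := (hz (m / p)).1.1
      rwa [show m / p * p = m by omega] at this
    · have := (hz (m / p)).2 (m % p) (by omega) h3
      rwa [h2] at this

theorem IsAlphabet.one_lt_dimH (hT : IsAlphabet lam p k H A q B T)
    (h : IsTractFamily lam p k H A) (hlam : lam ≠ 0) (hp : 1 ≤ p)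
    (hs : 1 < ∑ τ ∈ T, (stretch lam p k A B τ)⁻¹) : 1 < dimH (boundedItinerarySet lam p k H) := by
  have hTne : T.Nonempty := by
    rw [Finset.nonempty_iff_ne_empty]
    rintro rfl
    simp at hs
    linarith
  obtain ⟨M, hMT, hM⟩ : ∃ M ∈ T, ∀ τ ∈ T, τ ≤ M := T.exists_max_image id hTne
  have hst : ∀ τ ∈ T, 2 ≤ stretch lam p k A B τ := fun τ hτ => hT.two_le_stretch hp hτ
  classical
  let Z : (ℕ → ℕ) → ℂ := fun ω =>
    if hω : ∀ n, ω n ∈ T then (hT.codedPts_nonempty h hlam hp hω).some else 0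
  have hZ : ∀ ω : ℕ → ℕ, (∀ n, ω n ∈ T) → Z ω ∈ codedPts lam p k H q B ω := by
    intro ω hω
    simp only [Z, dif_pos hω]
    exact (hT.codedPts_nonempty h hlam hp hω).some_mem
  refine one_lt_dimH_of_coding (T := T) (c := fun τ => (stretch lam p k A B τ)⁻¹) (Z := Z)
    (K := stretch lam p k A B M) (fun τ hτ => inv_pos.2 (by linarith [hst τ hτ])) (fun τ hτ => ?_)
    hs (by linarith [hst M hMT])
    (fun ω hω => hT.codedPts_subset h hlam hp hω hM (hZ ω hω)) ?_
  · rw [one_div]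
    exact inv_anti₀ two_pos (hst τ hτ)
  · intro ω ω' hω hω' n heq hne
    have h0 := hZ ω hω
    have h0' := hZ ω' hω'
    cases n with
    | zero =>
      have h1 := hT.one_le_norm_sub h hne (by simpa using (h0 0).1.1) (by simpa using (h0' 0).1.1)
      simp only [Finset.range_zero, Finset.prod_empty]
      nlinarith [hst M hMT]
    -- The product of weights has one factor more than the distance estimate, that of `ω 0`; it only
    -- helps, since its stretch is at least `2`.
    | succ n =>
      have h1 := hT.one_le_mul_norm_sub h hlam hM hMT n ω ω' hω hω' heq hne _ _ h0 h0'
      rw [Finset.prod_inv_distrib, Finset.prod_range_succ']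
      set P := ∏ i ∈ Finset.range n, stretch lam p k A B (ω (i + 1))
      have hP : 0 < P := Finset.prod_pos fun i _ => by linarith [hst _ (hω (i + 1))]
      have h2 := hst _ (hω 0)
      rw [inv_le_iff_one_le_mul₀' (by positivity)]
      refine h1.trans ?_
      have h3 : 0 ≤ stretch lam p k A B M * P * ‖Z ω - Z ω'‖ := by linarith
      nlinarith

/-! ### Choice of the parameters -/

theorem IsTractFamily.exists_alphabet (h : IsTractFamily lam p k H A) (hp : 1 ≤ p) :
    ∃ q B T, IsAlphabet lam p k H A q B T ∧ 1 < ∑ τ ∈ T, (stretch lam p k A B τ)⁻¹ := by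
  obtain ⟨ρ, hρ⟩ := h.exists_re
  obtain ⟨t₀, ht₀⟩ := h.exists_pullback
  have hA : 0 ≤ A := by
    obtain ⟨z, hz, -⟩ := hρ 0
    exact (abs_nonneg _).trans (h.im_le 0 z hz)
  obtain ⟨q, hq⟩ := exists_nat_gt (max (2 * A + 1) 1)
  have hq1 : (1 : ℝ) ≤ q := (le_max_right _ _).trans hq.le
  have hqA : 2 * A + 1 ≤ q := (le_max_left _ _).trans hq.le
  have hpi := Real.pi_gt_three
  set B := 2 * Real.pi * q + 1 with hB
  have hB0 : 0 < B := by positivity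
  set c := branchBound lam p k A with hc
  have hcast : Tendsto (fun n : ℕ => (n : ℝ)) atTop atTop := tendsto_natCast_atTop_atTop
  have hBcast : Tendsto (fun n : ℕ => B * (n : ℝ)) atTop atTop := hcast.const_mul_atTop hB0
  have e1 : ∀ᶠ n : ℕ in atTop, A + |ρ| ≤ n := hcast.eventually_ge_atTop _
  have e2 : ∀ᶠ n : ℕ in atTop, t₀ < n := by
    filter_upwards [hcast.eventually_gt_atTop (t₀ : ℝ)] with n hn
    exact_mod_cast hn
  have e3 : ∀ᶠ n : ℕ in atTop, ∀ i ∈ Finset.range (p + 1), 2 ≤ (shiftLog (-c))^[i] (n : ℝ) :=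
    (Finset.eventually_all _).2 fun i _ =>
      ((tendsto_shiftLog_iterate (-c) i).comp hcast).eventually_ge_atTop 2
  have e3' : ∀ᶠ n : ℕ in atTop, ∀ i ∈ Finset.range (p + 1), 0 < (shiftLog c)^[i] (B * (n : ℝ)) :=
    (Finset.eventually_all _).2 fun i _ =>
      ((tendsto_shiftLog_iterate c i).comp hBcast).eventually_gt_atTop 0
  have e4 : ∀ᶠ n : ℕ in atTop, ∀ j ∈ Finset.range p, k j < (n : ℤ) := by
    refine (Finset.eventually_all _).2 fun j _ => ?_
    filter_upwards [hcast.eventually_gt_atTop (k j : ℝ)] with n hn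
    exact_mod_cast hn
  -- The iterated logarithm is `o(n)`. Hence from `N` on, symbols exceed its value at `B * N` by
  -- more than the increase by `B` that is allowed below.
  have e5 : ∀ᶠ n : ℕ in atTop, A + ((shiftLog c)^[p] (B * n) + 2 * B) ≤ n := by
    have h1 := hBcast.eventually
      ((isLittleO_shiftLog_iterate c hp).def (show 0 < 1 / (2 * B) by positivity))
    filter_upwards [h1, hcast.eventually_ge_atTop (2 * (A + 2 * B))] with n hn hn2
    rw [id, Real.norm_eq_abs, Real.norm_of_nonneg (by positivity)] at hn
    have h2 : 1 / (2 * B) * (B * n) = n / 2 := by field_simp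
    rw [h2] at hn
    linarith [le_abs_self ((shiftLog c)^[p] (B * n))]
  obtain ⟨N, hN⟩ := eventually_atTop.1 (e1.and (e2.and (e3.and (e3'.and (e4.and e5)))))
  -- The alphabet is `Ico N M` with `M` the first symbol at which the `p`-fold logarithm has risen
  -- by more than `B`. The rise makes the reciprocal sum exceed `1`; minimality keeps `log_bound`
  -- valid on the whole alphabet.
  have hex : ∃ M : ℕ, N ≤ M ∧ (shiftLog c)^[p] (B * N) + B < (shiftLog c)^[p] (B * M) :=
    ((eventually_ge_atTop N).and (((tendsto_shiftLog_iterate c p).comp hBcast).eventually_gt_atTop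
      ((shiftLog c)^[p] (B * N) + B))).exists
  classical
  obtain ⟨hM1, hM2⟩ := Nat.find_spec hex
  have hmin := fun m hm => Nat.find_min (m := m) hex hm
  set M := Nat.find hex
  have hmono : ∀ u v : ℕ, N ≤ u → u ≤ v → (shiftLog c)^[p] (B * u) ≤ (shiftLog c)^[p] (B * v) ∧
      ((shiftLog c)^[p] (B * v) - (shiftLog c)^[p] (B * u)) * stretch lam p k A B u
        ≤ B * v - B * u := fun u v hu huv =>
    shiftLog_iterate_sub_le (mul_le_mul_of_nonneg_left (Nat.cast_le.2 huv) hB0.le) p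
      fun i hi => (hN u hu).2.2.2.1 i (Finset.mem_range.2 (by omega))
  have hstp : ∀ u, N ≤ u → 0 < stretch lam p k A B u := fun u hu =>
    Finset.prod_pos fun i hi => (hN u hu).2.2.2.1 i
      (Finset.mem_range.2 (by have := Finset.mem_range.1 hi; omega))
  have htop : ∀ τ, N ≤ τ → τ < M → (shiftLog c)^[p] (B * τ) ≤ (shiftLog c)^[p] (B * N) + B := by
    intro τ h1 h2
    by_contra! h3
    exact hmin τ h2 ⟨h1, h3⟩
  have hqn : ∀ n : ℕ, (n : ℤ) ≤ (q * n : ℕ) := by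
    intro n
    have : 1 ≤ q := by exact_mod_cast hq1
    exact_mod_cast Nat.le_mul_of_pos_left n this
  refine ⟨q, B, Finset.Ico N M, ⟨by nlinarith, le_rfl, ?_, ?_, ?_, ?_, ?_, ?_⟩, ?_⟩
  · intro τ hτ σ hσ
    rw [Finset.mem_Ico] at hτ hσ
    have h1 := htop τ hτ.1 hτ.2
    have h2 := (hN N le_rfl).2.2.2.2.2
    have h3 : (N : ℝ) ≤ σ := by exact_mod_cast hσ.1
    linarith
  · intro τ hτ
    have h1 := (hN τ (Finset.mem_Ico.1 hτ).1).1
    have h2 : (τ : ℝ) * 2 ≤ τ * (2 * Real.pi * q) := by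
      refine mul_le_mul_of_nonneg_left ?_ (Nat.cast_nonneg _)
      nlinarith
    linarith [abs_nonneg ρ]
  · intro τ hτ i hi
    exact (hN τ (Finset.mem_Ico.1 hτ).1).2.2.1 i (Finset.mem_range.2 (by omega))
  · intro τ hτ x hx s
    exact ht₀ _ ((hN τ (Finset.mem_Ico.1 hτ).1).2.1.le.trans (hqn τ)) x hx s
  · choose x hx hxρ using hρ
    refine ⟨fun τ => x (q * τ : ℕ), fun τ hτ => ⟨hx _, ?_⟩⟩
    have h1 := h.abs_im_le (hx (q * τ : ℕ))
    have h2 := Complex.norm_le_abs_re_add_abs_im (x (q * τ : ℕ))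
    rw [hxρ] at h2
    rw [Int.cast_natCast, Nat.abs_cast] at h1
    push_cast at h1 h2
    have h3 := (hN τ (Finset.mem_Ico.1 hτ).1).1
    push_cast
    rw [hB]
    linarith
  · intro τ hτ j hj
    exact ((hN τ (Finset.mem_Ico.1 hτ).1).2.2.2.2.1 j (Finset.mem_range.2 hj)).trans_le (hqn τ)
  -- Each increment of the `p`-fold logarithm is at most `B` over the stretch. The increments
  -- telescope to more than `B`.
  · have h1 : ∀ τ ∈ Finset.Ico N M, (shiftLog c)^[p] (B * ((τ + 1 : ℕ) : ℝ))
        - (shiftLog c)^[p] (B * τ) ≤ B * (stretch lam p k A B τ)⁻¹ := by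
      intro τ hτ
      have hτN := (Finset.mem_Ico.1 hτ).1
      have h2 := (hmono τ (τ + 1) hτN (Nat.le_succ τ)).2
      rw [← div_eq_mul_inv, le_div_iff₀ (hstp τ hτN)]
      refine h2.trans (le_of_eq ?_)
      push_cast; ring
    have h2 := Finset.sum_le_sum h1
    rw [Finset.sum_Ico_sub (fun τ : ℕ => (shiftLog c)^[p] (B * (τ : ℝ))) hM1,
      ← Finset.mul_sum] at h2
    have h3 : B * 1 < B * ∑ τ ∈ Finset.Ico N M, (stretch lam p k A B τ)⁻¹ := by linarith
    exact lt_of_mul_lt_mul_left h3 hB0.le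

end ExpBasin

end

theorem mainTheorem5 (lam : ℂ) (hlam : lam ≠ 0) (p : ℕ) (hp : 2 ≤ p) (z₀ : ℂ)
    (hz₀ : ExpBasin.IsAttractingCycle lam p z₀)
    (D : Set ℂ) (hD : ExpBasin.IsInitialDomain lam p z₀ D)
    (C : Set ℂ) (hC : ExpBasin.IsTruncatedDomain lam p z₀ D C)
    (w : ℂ) (hw : w ∉ ExpBasin.cSet lam p z₀ C 0)
    (k : ℕ → ℤ)
    (hk : ∀ j : ℕ, 1 ≤ j → j < p →
      ExpBasin.basinComp lam p z₀ j ⊆ ExpBasin.hSet lam p z₀ C w (k j)) :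
    1 < dimH {z : ℂ | z ∈ ExpBasin.juliaSet (ExpBasin.expMap lam) ∧
      (∃ s ∈ ExpBasin.sigmaPrime p k,
        ExpBasin.IsItinerary lam (ExpBasin.hSet lam p z₀ C w) z s) ∧
      Bornology.IsBounded (range fun n : ℕ => (ExpBasin.expMap lam)^[n] z)} := by
  obtain ⟨A, hA⟩ := hz₀.isTractFamily hlam hp hD hC hw hk
  obtain ⟨q, B, T, hT, hs⟩ := hA.exists_alphabet (by omega)
  exact hT.one_lt_dimH hA hlam (by omega) hs
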